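/- A Markov decision process (MDP) $P=((V,E),\langle V_1,V_R\rangle,\delta)$ consists of a finite non-empty set $V$ of $n$ vertices partitioned into player-1 vertices $V_1$ and random vertices $V_R$, a set $E\subseteq V\times V$ of edges, without self-loops and such that every vertex has an outgoing edge, and a probability distribution $\delta(v)$ on $V$ for each $v\in V_R$, with $\delta(v)[w]>0$ if and only if $(v,w)\in E$. A strategy $\sigma$ of player 1 assigns to each finite history that ends in a vertex $v\in V_1$ a successor of $v$; $\Pr^\sigma_v$ is the law of the random play that starts in $v$ and follows $\sigma$ at player-1 vertices and $\delta$ at random vertices. For $T\subseteq V$ let $\mathrm{Reach}(T)$ be the set of infinite paths of $(V,E)$ that visit $T$, and let $\mathrm{ASW}(\mathrm{Reach}(T))$ be the set of vertices $v$ for which there is a strategy $\sigma$ with $\Pr_v^\sigma(\mathrm{Reach}(T))=1$. A set-based symbolic algorithm is a program of a random-access machine which can, besides computing with natural numbers, store sets of vertices and sets of edges, but has access to them only by the symbolic operations: $\cup,\cap,\setminus,\subseteq,=$ on two sets of vertices or two sets of edges; the product $\times$ of two sets of vertices; $\mathrm{Pre}_F(S)=\{v \mid \exists w\in S,\ (v,w)\in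 F\}$ and $\mathrm{Post}_F(S)=\{w\mid\exists v\in S,\ (v,w)\in F\}$ for a set $F$ of edges and a set $S$ of vertices; $\mathrm{Pick}(S)$, which returns an arbitrary vertex of $S$ (as a singleton set); and the cardinality $|S|$. Its time is the number of symbolic operations that it performs, and its symbolic space is the maximal number of sets that it stores simultaneously. Its input is $V$, $E$, $V_1$, $V_R$, $T$ (as stored sets) and one natural number $p$, the trade-off parameter. **Theorem.** There are a set-based symbolic algorithm $\mathcal A$ and constants $C,k$ such that for every MDP $P$ with $n$ vertices and every set $T$ of vertices, however the choices of $\mathrm{Pick}$ are made, the following holds. For every value of the parameter $p$, the algorithm halts and returns $\mathrm{ASW}(\mathrm{Reach}(T))$. For every real $\epsilon$ with $0<\epsilon\le 1/2$, when it is run with $p=\lceil n^\epsilon\rceil$ it performs at most $C\,n^{2-\epsilon}(\log n)^k$ symbolic operations and uses symbolic space at most $C\,n^{\epsilon}(\log n)^k$; that is, $\mathrm{ASW}(\mathrm{Reach}(T))$ is computed with $\widetilde O(n^{2-\epsilon})$ symbolic operations and $\widetilde O(n^{\epsilon})$ symbolic space. -/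

import Mathlib

open MeasureTheory ProbabilityTheory

/-! ### Markov decision processes and almost-sure reachability -/

/-- A Markov decision process on the vertex set `V`. The player-1 vertices are `V1`, the random
vertices are the remaining ones. There are no self-loops and every vertex has an outgoing edge. -/
structure MDP (V : Type*) where
  E : Set (V × V)
  V1 : Set V
  δ : (V1ᶜ : Set V) → PMF V
  mem_E_iff : ∀ (v : (V1ᶜ : Set V)) (w : V), ((v : V), w) ∈ E ↔ 0 < δ v w
  no_loop : ∀ v, (v, v) ∉ E
  exists_out : ∀ v, ∃ w, (v, w) ∈ E

namespace MDP

variable {V : Type*}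

/-- The random vertices. -/
def VR (P : MDP V) : Set V := P.V1ᶜ

/-- A (history-dependent) strategy of player 1: `move w v` is the successor chosen after the
history `w · v`, where `v` is a player-1 vertex. -/
structure Strategy (P : MDP V) where
  move : List V → P.V1 → V
  edge : ∀ (w : List V) (v : P.V1), ((v : V), move w v) ∈ P.E

open Classical in
/-- The distribution of the next vertex after the history `w · v`. -/
noncomputable def next (P : MDP V) (σ : P.Strategy) (w : List V) (v : V) : PMF V :=
  if h : v ∈ P.V1 then PMF.pure (σ.move w ⟨v, h⟩) else P.δ ⟨v, h⟩

/-- The distribution of the vertex number `n + 1` of a play, given the vertices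
number `0, …, n`. -/
noncomputable def stepKernel [Fintype V] [MeasurableSpace V] [DiscreteMeasurableSpace V]
    (P : MDP V) (σ : P.Strategy) (n : ℕ) : Kernel (Finset.Iic n → V) V :=
  Kernel.ofFunOfCountable fun h =>
    (P.next σ (List.ofFn fun i : Fin n => h ⟨i, Finset.mem_Iic.2 i.2.le⟩)
      (h ⟨n, Finset.mem_Iic.2 le_rfl⟩)).toMeasure

instance [Fintype V] [MeasurableSpace V] [DiscreteMeasurableSpace V]
    (P : MDP V) (σ : P.Strategy) (n : ℕ) : IsMarkovKernel (P.stepKernel σ n) :=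
  ⟨fun _ => PMF.toMeasure.isProbabilityMeasure _⟩

/-- The law of the random play that starts in `v` when player 1 follows `σ`. -/
noncomputable def law [Fintype V] [MeasurableSpace V] [DiscreteMeasurableSpace V]
    (P : MDP V) (σ : P.Strategy) (v : V) : Measure (ℕ → V) :=
  Kernel.traj (X := fun _ => V) (fun n => P.stepKernel σ n) 0 (fun _ => v)

/-- The plays: infinite paths. -/
def plays (P : MDP V) : Set (ℕ → V) := {ω | ∀ k, (ω k, ω (k + 1)) ∈ P.E}

/-- The reachability objective: some vertex of `T` is visited. -/
def Reach (P : MDP V) (T : Set V) : Set (ℕ → V) := {ω | ω ∈ P.plays ∧ ∃ k, ω k ∈ T}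

/-- The almost-sure winning set of the objective `Φ`. -/
def ASW [Fintype V] [MeasurableSpace V] [DiscreteMeasurableSpace V]
    (P : MDP V) (Φ : Set (ℕ → V)) : Set V :=
  {v | ∃ σ : P.Strategy, P.law σ v Φ = 1}

end MDP

/-! ### Set-based symbolic algorithms

A symbolic algorithm is a program of a random-access machine. Besides its number memory (cells
indexed by `ℕ`, holding natural numbers) the machine has cells for sets of vertices and cells for
sets of edges. Sets are only accessible through symbolic operations. Only the symbolic operations
are counted as time, and only stored sets are counted as space. -/

namespace Symbolic

/-- Arithmetic expressions over the number memory. `load` reads the cell whose address is the value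
of its argument; `sub` is truncated, `div` and `mod` are integral, `log` is the floor of the binary
logarithm. -/
inductive Expr where
  | const (n : ℕ)
  | load (a : Expr)
  | add (a b : Expr)
  | sub (a b : Expr)
  | mul (a b : Expr)
  | div (a b : Expr)
  | mod (a b : Expr)
  | pow (a b : Expr)
  | log (a : Expr)

/-- The value of an expression when the number memory is `m`. -/
def Expr.eval (m : ℕ → ℕ) : Expr → ℕ
  | .const n => n
  | .load a => m (a.eval m)
  | .add a b => a.eval m + b.eval m
  | .sub a b => a.eval m - b.eval m
  | .mul a b => a.eval m * b.eval m
  | .div a b => a.eval m / b.eval m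
  | .mod a b => a.eval m % b.eval m
  | .pow a b => a.eval m ^ b.eval m
  | .log a => Nat.log 2 (a.eval m)

/-- The basic set operations that return a set of the same kind as the operands. -/
inductive SetOp where
  | union
  | inter
  | diff

/-- The set that results from a basic set operation. -/
def SetOp.apply {α : Type*} : SetOp → Set α → Set α → Set α
  | .union, A, B => A ∪ B
  | .inter, A, B => A ∩ B
  | .diff, A, B => A \ B

/-- Symbolic operations. All arguments are expressions whose values are addresses: `dst` is the
address of the cell that receives the result, the others are those of the operands. -/
inductive Op where
  /-- a basic set operation on two sets of vertices -/
  | vertexOp (o : SetOp) (dst x y : Expr)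
  /-- a basic set operation on two sets of edges -/
  | edgeOp (o : SetOp) (dst x y : Expr)
  /-- inclusion test for sets of vertices; the result `0` or `1` is a number -/
  | vertexSubset (dst x y : Expr)
  /-- inclusion test for sets of edges -/
  | edgeSubset (dst x y : Expr)
  /-- equality test for sets of vertices -/
  | vertexEq (dst x y : Expr)
  /-- equality test for sets of edges -/
  | edgeEq (dst x y : Expr)
  /-- the product of two sets of vertices, a set of edges -/
  | prod (dst x y : Expr)
  /-- the predecessors of the set of vertices `x` with respect to the edge set `e` -/
  | pre (dst e x : Expr)
  /-- the successors of the set of vertices `x` with respect to the edge set `e` -/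
  | post (dst e x : Expr)
  /-- an arbitrary vertex of the set of vertices `x`, as a singleton -/
  | pick (dst x : Expr)
  /-- the cardinality of the set of vertices `x`, a number -/
  | card (dst x : Expr)

/-- Programs. -/
inductive Prog where
  | skip
  | seq (p q : Prog)
  /-- branch on whether the value of `b` is non-zero -/
  | ite (b : Expr) (p q : Prog)
  /-- repeat the body while the value of `b` is non-zero -/
  | loop (b : Expr) (p : Prog)
  /-- store the value of `e` in the number cell with address `a` -/
  | assign (a e : Expr)
  /-- discard the set of vertices in the cell with address `a` -/
  | freeVertex (a : Expr)
  /-- discard the set of edges in the cell with address `a` -/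
  | freeEdge (a : Expr)
  | op (o : Op)

/-- Configurations: the memory contents (`none` for a cell that stores no set), the number of
symbolic operations so far, and the maximal number of simultaneously stored sets so far. -/
structure State (V : Type*) where
  num : ℕ → ℕ
  vset : ℕ → Option (Set V)
  eset : ℕ → Option (Set (V × V))
  ops : ℕ
  peak : ℕ∞

/-- A resolution of the choices of the pick operation: the vertex picked from a set may depend on
the time, so that repeated picks from the same set may differ. -/
structure Picker (V : Type*) where
  choose : ℕ → Set V → V
  choose_mem : ∀ t S, S.Nonempty → choose t S ∈ S

namespace State

variable {V : Type*}

/-- The number of sets that are currently stored. -/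
noncomputable def stored (s : State V) : ℕ∞ :=
  {i | s.vset i ≠ none}.encard + {i | s.eset i ≠ none}.encard

/-- Update the maximal number of stored sets. -/
noncomputable def track (s : State V) : State V := { s with peak := max s.peak s.stored }

/-- The value of an expression. -/
def val (s : State V) (a : Expr) : ℕ := a.eval s.num

/-- The set of vertices in a cell; a cell that stores no set reads as the empty set. -/
def getV (s : State V) (a : Expr) : Set V := (s.vset (s.val a)).getD ∅

/-- The set of edges in a cell; a cell that stores no set reads as the empty set. -/
def getE (s : State V) (a : Expr) : Set (V × V) := (s.eset (s.val a)).getD ∅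

/-- Write a number. -/
def putN (s : State V) (a : Expr) (k : ℕ) : State V :=
  { s with num := Function.update s.num (s.val a) k }

/-- Write or discard a set of vertices. -/
def putV (s : State V) (a : Expr) (A : Option (Set V)) : State V :=
  { s with vset := Function.update s.vset (s.val a) A }

/-- Write or discard a set of edges. -/
def putE (s : State V) (a : Expr) (A : Option (Set (V × V))) : State V :=
  { s with eset := Function.update s.eset (s.val a) A }

open Classical in
/-- The effect of a symbolic operation on the memory. -/
noncomputable def effect (ρ : Picker V) (s : State V) : Op → State V
  | .vertexOp o d x y => s.putV d (some (o.apply (s.getV x) (s.getV y)))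
  | .edgeOp o d x y => s.putE d (some (o.apply (s.getE x) (s.getE y)))
  | .vertexSubset d x y => s.putN d (if s.getV x ⊆ s.getV y then 1 else 0)
  | .edgeSubset d x y => s.putN d (if s.getE x ⊆ s.getE y then 1 else 0)
  | .vertexEq d x y => s.putN d (if s.getV x = s.getV y then 1 else 0)
  | .edgeEq d x y => s.putN d (if s.getE x = s.getE y then 1 else 0)
  | .prod d x y => s.putE d (some (s.getV x ×ˢ s.getV y))
  | .pre d e x => s.putV d (some {v | ∃ w ∈ s.getV x, (v, w) ∈ s.getE e})
  | .post d e x => s.putV d (some {w | ∃ v ∈ s.getV x, (v, w) ∈ s.getE e})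
  | .pick d x => s.putV d (some {v | v ∈ s.getV x ∧ v = ρ.choose s.ops (s.getV x)})
  | .card d x => s.putN d (s.getV x).ncard

/-- Perform one symbolic operation, with the accounting of time and space. -/
noncomputable def perform (ρ : Picker V) (s : State V) (o : Op) : State V :=
  { (s.effect ρ o).track with ops := s.ops + 1 }

end State

/-- `Exec ρ p s s'`: the program `p`, started in the configuration `s`, halts in the
configuration `s'`, when the choices are resolved by `ρ`. -/
inductive Exec {V : Type*} (ρ : Picker V) : Prog → State V → State V → Prop where
  | skip (s) : Exec ρ .skip s s
  | seq {p q s t u} : Exec ρ p s t → Exec ρ q t u → Exec ρ (.seq p q) s u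
  | ite_true {b p q s t} : s.val b ≠ 0 → Exec ρ p s t → Exec ρ (.ite b p q) s t
  | ite_false {b p q s t} : s.val b = 0 → Exec ρ q s t → Exec ρ (.ite b p q) s t
  | loop_done {b p s} : s.val b = 0 → Exec ρ (.loop b p) s s
  | loop_step {b p s t u} : s.val b ≠ 0 → Exec ρ p s t → Exec ρ (.loop b p) t u →
      Exec ρ (.loop b p) s u
  | assign (a e s) : Exec ρ (.assign a e) s (s.putN a (s.val e))
  | freeVertex (a s) : Exec ρ (.freeVertex a) s (s.putV a none)
  | freeEdge (a s) : Exec ρ (.freeEdge a) s (s.putE a none)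
  | op (o s) : Exec ρ (.op o) s (s.perform ρ o)

/-- The initial configuration for the MDP `P`, the target set `T` and the number parameter `p`.
The vertex-set cells `0, 1, 2, 3` hold the set of all vertices, the player-1 vertices, the random
vertices and `T`; the edge-set cell `0` holds the edges; the number cell `0` holds `p`. -/
noncomputable def init {V : Type*} (P : MDP V) (T : Set V) (p : ℕ) : State V :=
  State.track
    { num := fun i => if i = 0 then p else 0
      vset := fun i => if i = 0 then some Set.univ else if i = 1 then some P.V1
        else if i = 2 then some P.VR else if i = 3 then some T else none
      eset := fun i => if i = 0 then some P.E else none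
      ops := 0
      peak := 0 }

/-- The program `A`, on the input `P`, `T` with number parameter `p`, halts in the configuration `s`
with the set of vertices `R` as its output, in the vertex-set cell `0`. -/
def Computes {V : Type*} (ρ : Picker V) (A : Prog) (P : MDP V) (T : Set V) (p : ℕ) (R : Set V)
    (s : State V) : Prop :=
  Exec ρ A (init P T p) s ∧ s.vset 0 = some R

end Symbolic

/-!
The winning region is the largest set `A` of vertices that contains the successors outside `T` of
its random vertices and in which every vertex has a path inside `A` to `T`: the memoryless strategy
that decreases the distance to `T` then reaches `T` almost surely, since the probability of never
reaching `T` is subharmonic and hence attains its maximum on `T`, where it is `0`.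

The algorithm shrinks a set of candidates that contains the winning region; removing a vertex
entails removing its random predecessors outside `T`. It names the vertices by binary numbers, which
takes about `log n` sets of vertices, one for each digit. Edges can then be kept in the number
memory, at a cost of about `log n` symbolic operations for each edge recorded, and computing with
recorded edges costs nothing. Once a vertex has at most `p` successors among the candidates, these
are recorded, which happens once for each vertex. Candidates from which no recorded path leads to
`T` or to a vertex that has not been recorded are losing and are found without symbolic operations.

When there are none left, a round searches backwards from `T` with `O(n)` symbolic operations. If a
candidate fails to reach `T`, then so does an unrecorded vertex, and with it all of its more than
`p` successors, which are removed. So there are at most `n / (p + 1) + 1` rounds, and up to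
logarithmic factors the cost is `n * p + n * n / p`, that is, `n ^ (2 - ε)` for `p = n ^ ε`.
-/

/-- `LeadsIn E A B k v`: in the graph `E` there is a path of length `k` from `v` to a vertex of `B`
all of whose vertices lie in `A`. -/
inductive LeadsIn {V : Type*} (E : Set (V × V)) (A B : Set V) : ℕ → V → Prop where
  | base {v} : v ∈ A → v ∈ B → LeadsIn E A B 0 v
  | step {k v w} : v ∈ A → (v, w) ∈ E → LeadsIn E A B k w → LeadsIn E A B (k + 1) v

/-- `Leads E A B v`: in the graph `E` there is a path from `v` to a vertex of `B` all of whose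
vertices lie in `A`. -/
def Leads {V : Type*} (E : Set (V × V)) (A B : Set V) (v : V) : Prop := ∃ k, LeadsIn E A B k v

section Leads

variable {V : Type*} {E : Set (V × V)} {A B C : Set V} {v w : V}

theorem LeadsIn.mem {k : ℕ} (h : LeadsIn E A B k v) : v ∈ A := by
  cases h <;> assumption

theorem Leads.base (hA : v ∈ A) (hB : v ∈ B) : Leads E A B v :=
  ⟨0, .base hA hB⟩

theorem Leads.step (hA : v ∈ A) (he : (v, w) ∈ E) : Leads E A B w → Leads E A B v
  | ⟨k, hk⟩ => ⟨k + 1, .step hA he hk⟩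

theorem Leads.trans (h : Leads E A B v) (hBC : ∀ u ∈ A ∩ B, Leads E A C u) :
    Leads E A C v := by
  obtain ⟨k, hk⟩ := h
  induction hk with
  | base hA hB => exact hBC _ ⟨hA, hB⟩
  | step hA he _ ih => exact .step hA he ih

theorem exists_rank_of_leads (h : ∀ v ∈ A, Leads E A B v) :
    ∃ d : V → ℕ, ∀ v ∈ A, v ∉ B → ∃ w ∈ A, (v, w) ∈ E ∧ d w < d v := by
  refine ⟨fun v => sInf {k | LeadsIn E A B k v}, fun v hA hB => ?_⟩
  have hshortest : LeadsIn E A B (sInf {k | LeadsIn E A B k v}) v := Nat.sInf_mem (h v hA)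
  cases hk : sInf {k | LeadsIn E A B k v} with
  | zero =>
    rw [hk] at hshortest
    cases hshortest with | base _ hv => exact absurd hv hB
  | succ k =>
    rw [hk] at hshortest
    cases hshortest with
    | step _ he hw => exact ⟨_, hw.mem, he, (Nat.lt_succ_of_le (Nat.sInf_le hw)).trans_eq hk.symm⟩

/-- A maximum principle: if a function is subharmonic for the transition matrix `q` on `A \ B`, and
`q` leads from every vertex of `A` to `B` within `A`, then it attains its maximum on `B`. -/
theorem le_of_subharmonic [Fintype V] {q : V → V → ℝ} {g : V → ℝ} {d : V → ℕ} {M : ℝ}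
    (nonneg : ∀ v w, 0 ≤ q v w) (sum_eq_one : ∀ v, ∑ w, q v w = 1)
    (closed : ∀ v ∈ A, v ∉ B → ∀ w, q v w ≠ 0 → w ∈ A)
    (descent : ∀ v ∈ A, v ∉ B → ∃ w, q v w ≠ 0 ∧ d w < d v)
    (subharmonic : ∀ v ∈ A, v ∉ B → g v ≤ ∑ w, q v w * g w)
    (boundary : ∀ v ∈ B, g v ≤ M) : ∀ v ∈ A, g v ≤ M := by
  intro v hv
  -- Among the vertices of `A` at which `g` is maximal, take one at which `d` is minimal.
  obtain ⟨u, hu, hmax⟩ := A.toFinite.exists_maximalFor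
    (fun v => toLex (g v, OrderDual.toDual (d v))) A ⟨v, hv⟩
  have hlex : ∀ w ∈ A, g w < g u ∨ g w = g u ∧ d u ≤ d w := fun w hw => by
    have := (le_total _ _).elim id (hmax hw)
    simpa only [Prod.Lex.le_iff, ofLex_toLex, OrderDual.toDual_le_toDual] using this
  have hle : ∀ w ∈ A, g w ≤ g u := fun w hw => (hlex w hw).elim le_of_lt fun h => h.1.le
  refine (hle v hv).trans (boundary u (by_contra fun hB => ?_))
  obtain ⟨w, hqw, hdw⟩ := descent u hu hB
  have hlt : g w < g u :=
    (hlex w (closed u hu hB w hqw)).resolve_right fun h => hdw.not_ge h.2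
  have hterm : ∀ x, q u x * g x ≤ q u x * g u := fun x => by
    by_cases hx : q u x = 0
    · simp only [hx, zero_mul, le_refl]
    · exact mul_le_mul_of_nonneg_left (hle x (closed u hu hB x hx)) (nonneg u x)
  have hsum : ∑ x, q u x * g x < ∑ x, q u x * g u :=
    Finset.sum_lt_sum (fun x _ => hterm x)
      ⟨w, Finset.mem_univ w, mul_lt_mul_of_pos_left hlt ((nonneg u w).lt_of_ne' hqw)⟩
  rw [← Finset.sum_mul, sum_eq_one, one_mul] at hsum
  exact (subharmonic u hu hB).not_gt hsum

end Leads

namespace MDP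

variable {V : Type*}

/-- The sequences that agree with `a` up to time `k`. -/
def cylinder (a : ℕ → V) (k : ℕ) : Set (ℕ → V) := {ω | ∀ i ≤ k, ω i = a i}

theorem cylinder_subset (a : ℕ → V) {j k : ℕ} (h : j ≤ k) : cylinder a k ⊆ cylinder a j :=
  fun _ hω i hi => hω i (hi.trans h)

/-- The sequence that starts with `v` and continues with `ω`. -/
def consPlay (v : V) (ω : ℕ → V) : ℕ → V
  | 0 => v
  | k + 1 => ω k

theorem cylinder_eq_preimage (a : ℕ → V) (k : ℕ) :
    cylinder a k = Preorder.frestrictLe (π := fun _ => V) k ⁻¹' {fun i : Finset.Iic k => a i} := by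
  ext ω
  simp only [cylinder, Set.mem_ofPred_eq, Set.mem_preimage, Set.mem_singleton_iff, funext_iff,
    Subtype.forall, Finset.mem_Iic, Preorder.frestrictLe_apply]

theorem measurable_consPlay [MeasurableSpace V] (v : V) : Measurable (consPlay v) := by
  refine measurable_pi_lambda _ fun k => ?_
  cases k with
  | zero => exact measurable_const
  | succ k => exact measurable_pi_apply k

section Measurability

variable [MeasurableSpace V] [DiscreteMeasurableSpace V]

theorem measurableSet_cylinder (a : ℕ → V) (k : ℕ) : MeasurableSet (cylinder a k) := by
  rw [cylinder_eq_preimage]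
  exact measurableSet_preimage (Preorder.measurable_frestrictLe (X := fun _ : ℕ => V) _)
    (MeasurableSet.singleton _)

theorem ext_of_cylinder [Countable V] {μ ν : Measure (ℕ → V)} [IsFiniteMeasure μ]
    [IsFiniteMeasure ν] (h : ∀ a k, μ (cylinder a (k + 1)) = ν (cylinder a (k + 1))) : μ = ν := by
  have hproj : IsProjectiveMeasureFamily (α := fun _ : ℕ => V)
      (fun I : Finset ℕ => ν.map I.restrict) := by
    intro I J hJI
    simp only
    rw [Measure.map_map (by fun_prop) (by fun_prop)]
    rfl
  have hν : IsProjectiveLimit ν (fun I : Finset ℕ => ν.map I.restrict) := fun I => rfl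
  refine IsProjectiveLimit.unique (α := fun _ : ℕ => V)
    (P := fun I : Finset ℕ => ν.map I.restrict) ?_ hν
  rw [isProjectiveLimit_nat_iff' hproj _ 1]
  intro n hn
  obtain ⟨k, rfl⟩ : ∃ k, n = k + 1 := ⟨n - 1, by omega⟩
  refine Measure.ext_of_singleton fun b => ?_
  change _ = (ν.map (Preorder.frestrictLe (π := fun _ => V) (k + 1))) {b}
  rw [Measure.map_apply (by fun_prop) (by measurability),
    Measure.map_apply (by fun_prop) (by measurability)]
  obtain ⟨a, rfl⟩ : ∃ a : ℕ → V, b = fun i : Finset.Iic (k + 1) => a i :=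
    ⟨fun j => b ⟨min j (k + 1), Finset.mem_Iic.2 (min_le_right _ _)⟩, funext fun i =>
      congrArg b (Subtype.ext (min_eq_left (Finset.mem_Iic.1 i.2)).symm)⟩
  rw [← cylinder_eq_preimage]
  exact h _ _

end Measurability

/-- The strategy that continues `σ` after the first vertex `v`. -/
def Strategy.shift {P : MDP V} (σ : P.Strategy) (v : V) : P.Strategy where
  move w u := σ.move (v :: w) u
  edge w u := σ.edge (v :: w) u

theorem next_shift (P : MDP V) (σ : P.Strategy) (v : V) (w : List V) (u : V) :
    P.next (σ.shift v) w u = P.next σ (v :: w) u := rfl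

theorem edge_of_next_pos (P : MDP V) (σ : P.Strategy) (l : List V) (v w : V)
    (h : P.next σ l v w ≠ 0) : (v, w) ∈ P.E := by
  unfold next at h
  split_ifs at h with hv
  · have : w = σ.move l ⟨v, hv⟩ := by
      by_contra hne
      exact h (by simp [PMF.pure_apply, hne])
    exact this ▸ σ.edge l ⟨v, hv⟩
  · exact (P.mem_E_iff ⟨v, hv⟩ w).2 (pos_iff_ne_zero.2 h)

theorem next_pos_of_random (P : MDP V) (σ : P.Strategy) (l : List V) (v w : V)
    (hv : v ∉ P.V1) (h : (v, w) ∈ P.E) : P.next σ l v w ≠ 0 := by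
  unfold next
  rw [dif_neg hv]
  exact ((P.mem_E_iff ⟨v, hv⟩ w).1 h).ne'

theorem sum_next [Fintype V] (P : MDP V) (σ : P.Strategy) (l : List V) (v : V) :
    ∑ w, P.next σ l v w = 1 := by
  rw [← tsum_fintype (L := .unconditional V)]
  exact PMF.tsum_coe _

section Law

variable [Fintype V] [MeasurableSpace V] [DiscreteMeasurableSpace V] (P : MDP V) (σ : P.Strategy)

instance (v : V) : IsProbabilityMeasure (P.law σ v) := by
  unfold law; infer_instance

theorem law_cylinder_zero (v : V) (a : ℕ → V) [Decidable (a 0 = v)] :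
    P.law σ v (cylinder a 0) = if a 0 = v then 1 else 0 := by
  have h := congrArg (fun μ : Measure (Finset.Iic 0 → V) => μ {fun i : Finset.Iic 0 => a i})
    (Kernel.traj_map_frestrictLe_apply (X := fun _ => V) (κ := fun n => P.stepKernel σ n) 0 0
      (fun _ => v))
  rw [Kernel.partialTraj_self, Kernel.id_apply] at h
  rw [Measure.map_apply (by fun_prop) (by measurability), ← cylinder_eq_preimage] at h
  rw [law, h, Measure.dirac_apply' _ (by measurability)]
  split_ifs with hv
  · refine Set.indicator_of_mem (Set.mem_singleton_iff.2 (funext fun i => ?_)) _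
    rw [← hv, Nat.le_zero.1 (Finset.mem_Iic.1 i.2)]
  · exact Set.indicator_of_notMem (fun H => hv
      (congrFun (Set.mem_singleton_iff.1 H) (⟨0, by simp⟩ : Finset.Iic 0)).symm) _

theorem law_cylinder_succ (v : V) (a : ℕ → V) (k : ℕ) :
    P.law σ v (cylinder a (k + 1)) = P.law σ v (cylinder a k) *
      P.next σ (List.ofFn fun i : Fin k => a i) (a k) (a (k + 1)) := by
  have h := congrArg (fun μ : Measure ((Finset.Iic k → V) × V) =>
      μ ({fun i : Finset.Iic k => a i} ×ˢ {a (k + 1)}))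
    (Kernel.partialTraj_compProd_eq_map_traj (X := fun _ => V) (κ := fun n => P.stepKernel σ n)
      (Nat.zero_le k) (x₀ := fun _ => v))
  rw [Measure.compProd_apply_prod (by measurability) (by measurability),
    Measure.map_apply (by fun_prop) (by measurability), lintegral_singleton,
    ← Kernel.traj_map_frestrictLe_apply, Measure.map_apply (by fun_prop) (by measurability),
    ← cylinder_eq_preimage] at h
  have hc : cylinder a (k + 1) = (fun x : ℕ → V => (Preorder.frestrictLe (π := fun _ => V) k x,
      x (k + 1))) ⁻¹' ({fun i : Finset.Iic k => a i} ×ˢ {a (k + 1)}) := by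
    ext ω
    simp only [cylinder, Set.mem_ofPred_eq, Set.mem_preimage, Set.mem_prod, Set.mem_singleton_iff,
      funext_iff, Subtype.forall, Finset.mem_Iic, Preorder.frestrictLe_apply]
    exact ⟨fun H => ⟨fun i hi => H i (by omega), H _ le_rfl⟩, fun H i hi => by
      rcases Nat.lt_or_ge k i with hk | hk
      · obtain rfl : i = k + 1 := by omega
        exact H.2
      · exact H.1 i hk⟩
  rw [law, hc, ← h, mul_comm]
  congr 1
  exact (PMF.toMeasure_apply_singleton _ _ (by measurability))

theorem law_cylinder_shift (v : V) (a : ℕ → V) (k : ℕ) :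
    P.law σ v (cylinder a (k + 1)) = P.law σ v (cylinder a 0) * (P.next σ [] v (a 1) *
      P.law (σ.shift v) (a 1) (cylinder (fun i => a (i + 1)) k)) := by
  classical
  by_cases hv : a 0 = v
  swap
  · have h0 : P.law σ v (cylinder a 0) = 0 := by rw [law_cylinder_zero, if_neg hv]
    rw [h0, zero_mul]
    exact measure_mono_null (cylinder_subset _ (Nat.zero_le _)) h0
  induction k with
  | zero =>
    rw [law_cylinder_succ, law_cylinder_zero (P := P) (σ := σ.shift v)]
    simp [hv]
  | succ k ih =>
    rw [law_cylinder_succ, ih, law_cylinder_succ _ _ _ _ k, next_shift, List.ofFn_succ]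
    simp only [Fin.val_zero, Fin.val_succ, hv, mul_assoc]

theorem law_eq_sum (v : V) : P.law σ v =
    ∑ w, P.next σ [] v w • (P.law (σ.shift v) w).map (consPlay v) := by
  classical
  have hfin : IsFiniteMeasure (∑ w, P.next σ [] v w •
      (P.law (σ.shift v) w).map (consPlay v)) := by
    refine ⟨?_⟩
    rw [Measure.finsetSum_apply]
    refine ENNReal.sum_lt_top.2 fun w _ => ?_
    rw [Measure.smul_apply, smul_eq_mul]
    exact ENNReal.mul_lt_top (PMF.apply_lt_top _ _) (measure_lt_top _ _)
  refine ext_of_cylinder fun a k => ?_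
  have hmeas := measurableSet_cylinder a (k + 1)
  rw [Measure.finsetSum_apply]
  simp only [Measure.smul_apply, smul_eq_mul, Measure.map_apply (measurable_consPlay v) hmeas]
  rw [law_cylinder_shift, law_cylinder_zero]
  by_cases hv : a 0 = v
  · have hpre : consPlay v ⁻¹' cylinder a (k + 1) = cylinder (fun i => a (i + 1)) k := by
      ext ω
      refine ⟨fun H i hi => H (i + 1) (by omega), fun H i hi => ?_⟩
      cases i with
      | zero => exact hv.symm
      | succ i => exact H i (by omega)
    rw [if_pos hv, one_mul, hpre, Finset.sum_eq_single (a 1)]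
    · intro w _ hw
      have h0 : P.law (σ.shift v) w (cylinder (fun i => a (i + 1)) 0) = 0 := by
        rw [law_cylinder_zero, if_neg (Ne.symm hw)]
      rw [measure_mono_null (cylinder_subset _ (Nat.zero_le _)) h0, mul_zero]
    · simp
  · have hpre : consPlay v ⁻¹' cylinder a (k + 1) = ∅ :=
      Set.eq_empty_of_forall_notMem fun ω H => hv (H 0 (by omega)).symm
    simp [hv, hpre]

theorem law_apply (v : V) {Φ : Set (ℕ → V)} (hΦ : MeasurableSet Φ) : P.law σ v Φ =
    ∑ w, P.next σ [] v w * P.law (σ.shift v) w (consPlay v ⁻¹' Φ) := by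
  conv_lhs => rw [law_eq_sum]
  rw [Measure.finsetSum_apply]
  simp only [Measure.smul_apply, smul_eq_mul, Measure.map_apply (measurable_consPlay v) hΦ]

end Law

theorem nonempty_strategy (P : MDP V) : Nonempty P.Strategy := by
  choose f hf using P.exists_out
  exact ⟨⟨fun _ v => f v, fun _ v => hf v⟩⟩

theorem measurableSet_of_coord [MeasurableSpace V] [DiscreteMeasurableSpace V] (S : Set V)
    (k : ℕ) : MeasurableSet {ω : ℕ → V | ω k ∈ S} :=
  measurable_pi_apply k (MeasurableSet.of_discrete (s := S))

/-- The sequences that avoid `T`. -/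
def miss (T : Set V) : Set (ℕ → V) := {ω | ∀ k, ω k ∈ Tᶜ}

theorem measurableSet_miss [MeasurableSpace V] [DiscreteMeasurableSpace V] (T : Set V) :
    MeasurableSet (miss T) := by
  have : miss T = ⋂ k, {ω : ℕ → V | ω k ∈ Tᶜ} := by ext ω; simp [miss]
  rw [this]
  exact MeasurableSet.iInter fun k => measurableSet_of_coord _ _

theorem measurableSet_of_coords [Countable V] [MeasurableSpace V] [DiscreteMeasurableSpace V]
    (S : Set (V × V)) (k : ℕ) : MeasurableSet {ω : ℕ → V | (ω k, ω (k + 1)) ∈ S} :=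
  (measurable_pi_apply k).prodMk (measurable_pi_apply (k + 1)) (MeasurableSet.of_discrete (s := S))

variable [Fintype V] [MeasurableSpace V] [DiscreteMeasurableSpace V] (P : MDP V)

theorem law_start (σ : P.Strategy) (v : V) {S : Set V} (hS : v ∉ S) :
    P.law σ v {ω | ω 0 ∈ S} = 0 := by
  classical
  have h := P.law_cylinder_zero σ v (fun _ => v)
  rw [if_pos rfl, ← prob_compl_eq_zero_iff (measurableSet_cylinder _ _)] at h
  refine measure_mono_null (fun ω hω => ?_) h
  exact fun H : ω ∈ cylinder _ 0 => hS (H 0 le_rfl ▸ hω)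

theorem law_edge (k : ℕ) : ∀ (σ : P.Strategy) (v : V),
    P.law σ v {ω | (ω k, ω (k + 1)) ∈ P.Eᶜ} = 0 := by
  induction k with
  | zero =>
    intro σ v
    rw [law_apply _ _ _ (measurableSet_of_coords _ _)]
    refine Finset.sum_eq_zero fun w _ => ?_
    by_cases hw : P.next σ [] v w = 0
    · rw [hw, zero_mul]
    · exact mul_eq_zero_of_right _ (P.law_start (σ.shift v) w (S := {u | (v, u) ∈ P.Eᶜ})
        (fun H => H (P.edge_of_next_pos σ _ v w hw)))
  | succ k ih =>
    intro σ v
    rw [law_apply _ _ _ (measurableSet_of_coords _ _)]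
    exact Finset.sum_eq_zero fun w _ => mul_eq_zero_of_right _ (ih _ _)

theorem law_reach_eq_one_iff (σ : P.Strategy) (v : V) (T : Set V) :
    P.law σ v (P.Reach T) = 1 ↔ P.law σ v (miss T) = 0 := by
  have hplays : P.law σ v (⋃ k, {ω | (ω k, ω (k + 1)) ∈ P.Eᶜ}) = 0 :=
    measure_iUnion_null fun k => P.law_edge k σ v
  have hc : (P.Reach T)ᶜ = (⋃ k, {ω | (ω k, ω (k + 1)) ∈ P.Eᶜ}) ∪ miss T := by
    ext ω
    simp only [Reach, plays, miss, Set.mem_compl_iff, Set.mem_ofPred_eq, Set.mem_union,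
      Set.mem_iUnion, not_and_or, not_forall, not_exists]
  have hm : MeasurableSet (P.Reach T) := by
    rw [← compl_compl (P.Reach T), hc]
    exact ((MeasurableSet.iUnion fun k => measurableSet_of_coords _ _).union
      (measurableSet_miss T)).compl
  rw [← prob_compl_eq_zero_iff hm, hc]
  exact ⟨fun h => measure_mono_null Set.subset_union_right h, fun h => measure_union_null hplays h⟩

theorem mem_asw_iff (T : Set V) (v : V) :
    v ∈ P.ASW (P.Reach T) ↔ ∃ σ, P.law σ v (miss T) = 0 :=
  exists_congr fun σ => P.law_reach_eq_one_iff σ v T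

theorem law_miss_of_mem (σ : P.Strategy) {T : Set V} {v : V} (hv : v ∈ T) :
    P.law σ v (miss T) = 0 :=
  measure_mono_null (fun _ h => h 0) (P.law_start σ v (S := Tᶜ) (fun h => h hv))

theorem law_miss_of_notMem (σ : P.Strategy) {T : Set V} {v : V} (hv : v ∉ T) :
    P.law σ v (miss T) = ∑ w, P.next σ [] v w * P.law (σ.shift v) w (miss T) := by
  rw [law_apply _ _ _ (measurableSet_miss T)]
  have : consPlay v ⁻¹' miss T = miss T := by
    ext ω
    refine ⟨fun h k => h (k + 1), fun h k => ?_⟩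
    cases k with
    | zero => exact hv
    | succ k => exact h k
  rw [this]

theorem law_miss_shift (σ : P.Strategy) {T : Set V} {v w : V} (hv : v ∉ T)
    (h : P.law σ v (miss T) = 0) (hw : P.next σ [] v w ≠ 0) :
    P.law (σ.shift v) w (miss T) = 0 := by
  rw [P.law_miss_of_notMem σ hv, Finset.sum_eq_zero_iff] at h
  exact (mul_eq_zero.1 (h w (Finset.mem_univ w))).resolve_left hw

theorem subset_asw_reach (T : Set V) : T ⊆ P.ASW (P.Reach T) := fun v hv =>
  (P.mem_asw_iff T v).2 (P.nonempty_strategy.elim fun σ => ⟨σ, P.law_miss_of_mem σ hv⟩)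

theorem asw_reach_random {T : Set V} {v w : V} (hv : v ∈ P.ASW (P.Reach T)) (hR : v ∈ P.VR)
    (hT : v ∉ T) (he : (v, w) ∈ P.E) : w ∈ P.ASW (P.Reach T) := by
  obtain ⟨σ, hσ⟩ := (P.mem_asw_iff T v).1 hv
  exact (P.mem_asw_iff T w).2
    ⟨σ.shift v, P.law_miss_shift σ hT hσ (P.next_pos_of_random σ [] v w hR he)⟩

theorem law_hit_eq_zero (T : Set V) (k : ℕ) : ∀ (σ : P.Strategy) (v : V),
    P.law σ v (miss T) = 0 → ¬ Leads P.E (P.ASW (P.Reach T)) T v →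
    P.law σ v {ω | ω k ∈ T} = 0 := by
  induction k with
  | zero =>
    intro σ v hσ hv
    exact P.law_start σ v fun hT => hv (.base ((P.mem_asw_iff T v).2 ⟨σ, hσ⟩) hT)
  | succ k ih =>
    intro σ v hσ hv
    have hW := (P.mem_asw_iff T v).2 ⟨σ, hσ⟩
    rw [law_apply _ _ _ (measurableSet_of_coord _ _)]
    refine Finset.sum_eq_zero fun w _ => ?_
    by_cases hw : P.next σ [] v w = 0
    · rw [hw, zero_mul]
    · exact mul_eq_zero_of_right _ (ih _ _ (P.law_miss_shift σ (fun hT => hv (.base hW hT)) hσ hw)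
        fun hl => hv (.step hW (P.edge_of_next_pos σ _ v w hw) hl))

theorem asw_reach_leads {T : Set V} {v : V} (hv : v ∈ P.ASW (P.Reach T)) :
    Leads P.E (P.ASW (P.Reach T)) T v := by
  by_contra hl
  obtain ⟨σ, hσ⟩ := (P.mem_asw_iff T v).1 hv
  have h0 : P.law σ v (miss T ∪ ⋃ k, {ω | ω k ∈ T}) = 0 :=
    measure_union_null hσ (measure_iUnion_null fun k => P.law_hit_eq_zero T k σ v hσ hl)
  have hu : miss T ∪ ⋃ k, {ω : ℕ → V | ω k ∈ T} = Set.univ := by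
    refine Set.eq_univ_of_forall fun ω => ?_
    by_cases h : ∃ k, ω k ∈ T
    · exact Or.inr (Set.mem_iUnion.2 h)
    · exact Or.inl fun k hk => h ⟨k, hk⟩
  rw [hu, measure_univ] at h0
  exact one_ne_zero h0

/-- The strategy that moves from `v` to `f v` whatever the history is. -/
def Strategy.memoryless {V : Type*} {P : MDP V} (f : V → V) (hf : ∀ v, (v, f v) ∈ P.E) :
    P.Strategy where
  move _ v := f v
  edge _ v := hf v

section Memoryless

variable {V : Type*} {P : MDP V} {f : V → V} (hf : ∀ v, (v, f v) ∈ P.E)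

theorem next_memoryless_ne_zero (l : List V) (v : V) :
    P.next (.memoryless f hf) l v (f v) ≠ 0 := by
  by_cases hv : v ∈ P.V1
  · simp [next, hv, Strategy.memoryless]
  · exact P.next_pos_of_random _ l v _ hv (hf v)

theorem eq_of_next_memoryless_ne_zero {l : List V} {v w : V} (hv : v ∈ P.V1)
    (h : P.next (.memoryless f hf) l v w ≠ 0) : w = f v := by
  simpa [next, hv, Strategy.memoryless, PMF.pure_apply] using h

end Memoryless

theorem subset_asw_of_closed {T A : Set V}
    (hR : ∀ v ∈ A, v ∈ P.VR → v ∉ T → ∀ w, (v, w) ∈ P.E → w ∈ A)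
    (hL : ∀ v ∈ A, Leads P.E A T v) : A ⊆ P.ASW (P.Reach T) := by
  classical
  obtain ⟨d, hd⟩ := exists_rank_of_leads hL
  have hsucc : ∀ v, ∃ w, (v, w) ∈ P.E ∧ (v ∈ A → v ∉ T → w ∈ A ∧ d w < d v) := fun v => by
    by_cases h : v ∈ A ∧ v ∉ T
    · obtain ⟨w, hw, he, hlt⟩ := hd v h.1 h.2
      exact ⟨w, he, fun _ _ => ⟨hw, hlt⟩⟩
    · exact (P.exists_out v).imp fun w he => ⟨he, fun h1 h2 => absurd ⟨h1, h2⟩ h⟩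
  choose f hf hfd using hsucc
  let σ : P.Strategy := .memoryless f hf
  let q : V → V → ℝ := fun v w => (P.next σ [] v w).toReal
  have ne_zero_of_q : ∀ {v w}, q v w ≠ 0 → P.next σ [] v w ≠ 0 := fun h =>
    (ENNReal.toReal_ne_zero.1 h).1
  have closed : ∀ v ∈ A, v ∉ T → ∀ w, q v w ≠ 0 → w ∈ A := fun v hv hT w hw => by
    by_cases h1 : v ∈ P.V1
    · exact eq_of_next_memoryless_ne_zero hf h1 (ne_zero_of_q hw) ▸ (hfd v hv hT).1
    · exact hR v hv h1 hT w (P.edge_of_next_pos σ _ v w (ne_zero_of_q hw))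
  have sum_eq_one : ∀ v, ∑ w, q v w = 1 := fun v => by
    rw [← ENNReal.toReal_sum fun w _ => PMF.apply_ne_top _ _, P.sum_next σ [] v,
      ENNReal.toReal_one]
  have harmonic : ∀ v ∉ T, (P.law σ v).real (miss T) =
      ∑ w, q v w * (P.law σ w).real (miss T) := fun v hT => by
    simp only [q, Measure.real, ← ENNReal.toReal_mul]
    rw [← ENNReal.toReal_sum fun w _ =>
      ENNReal.mul_ne_top (PMF.apply_ne_top _ _) (measure_ne_top _ _), P.law_miss_of_notMem σ hT]
    rfl
  have hmax := le_of_subharmonic (fun _ _ => ENNReal.toReal_nonneg) sum_eq_one closed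
    (fun v hv hT => ⟨f v, ENNReal.toReal_ne_zero.2
      ⟨next_memoryless_ne_zero hf [] v, PMF.apply_ne_top _ _⟩, (hfd v hv hT).2⟩)
    (fun v _ hT => (harmonic v hT).le)
    (fun v hT => ((measureReal_eq_zero_iff).2 (P.law_miss_of_mem σ hT)).le)
  exact fun v hv => (P.mem_asw_iff T v).2
    ⟨σ, (measureReal_eq_zero_iff).1 (le_antisymm (hmax v hv) measureReal_nonneg)⟩

theorem two_le_card {V : Type*} [Finite V] [Nonempty V] (P : MDP V) : 2 ≤ Nat.card V := by
  obtain ⟨v⟩ := ‹Nonempty V›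
  obtain ⟨w, hw⟩ := P.exists_out v
  have : Nontrivial V := ⟨v, w, fun h => P.no_loop v (by rwa [← h] at hw)⟩
  exact Finite.one_lt_card

end MDP

namespace Symbolic

/-- `Arith p m m'`: the program `p` uses no symbolic operation and takes the number memory from `m`
to `m'`. Such computations are free. -/
inductive Arith : Prog → (ℕ → ℕ) → (ℕ → ℕ) → Prop where
  | assign (a e m) : Arith (.assign a e) m (Function.update m (a.eval m) (e.eval m))
  | skip (m) : Arith .skip m m
  | seq {p q m₁ m₂ m₃} : Arith p m₁ m₂ → Arith q m₂ m₃ → Arith (.seq p q) m₁ m₃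
  | loop_done {b p m} : b.eval m = 0 → Arith (.loop b p) m m
  | loop_step {b p m₁ m₂ m₃} : b.eval m₁ ≠ 0 → Arith p m₁ m₂ → Arith (.loop b p) m₂ m₃ →
      Arith (.loop b p) m₁ m₃

theorem Arith.exec {V : Type*} (ρ : Picker V) {p : Prog} {m m' : ℕ → ℕ} (h : Arith p m m')
    (s : State V) (hs : s.num = m) : Exec ρ p s { s with num := m' } := by
  induction h generalizing s with
  | assign a e m => subst hs; exact .assign a e s
  | skip => subst hs; exact .skip s
  | seq _ _ ih₁ ih₂ => exact .seq (ih₁ s hs) (ih₂ _ rfl)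
  | loop_done hb => subst hs; exact .loop_done hb
  | loop_step hb _ _ ih₁ ih₂ => subst hs; exact .loop_step hb (ih₁ s rfl) (ih₂ _ rfl)

theorem Arith.loop_of_iterate {b : Expr} {p : Prog} {N : ℕ} (I : ℕ → (ℕ → ℕ) → Prop)
    (guard : ∀ k m, I k m → b.eval m = N - k)
    (step : ∀ k m, k < N → I k m → ∃ m', Arith p m m' ∧ I (k + 1) m')
    {k : ℕ} {m : ℕ → ℕ} (hk : k ≤ N) (hI : I k m) : ∃ m', Arith (.loop b p) m m' ∧ I N m' := by
  induction hk using Nat.decreasingInduction generalizing m with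
  | self => exact ⟨m, .loop_done (by rw [guard N m hI, Nat.sub_self]), hI⟩
  | of_succ k hk ih =>
    obtain ⟨m₁, h₁, hI₁⟩ := step k m hk hI
    obtain ⟨m₂, h₂, hI₂⟩ := ih hI₁
    exact ⟨m₂, .loop_step (by rw [guard k m hI]; omega) h₁ h₂, hI₂⟩

/-- `Evaluates p d F`: the arithmetic program `p` stores the value of `F` in the number cell `d` and
preserves the cells below `d`; it may use the cells above `d` as working memory. -/
def Evaluates (p : Prog) (d : ℕ) (F : (ℕ → ℕ) → ℕ) : Prop :=
  ∀ m, ∃ m', Arith p m m' ∧ m' d = F m ∧ ∀ j < d, m' j = m j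

theorem Evaluates.assign (d : ℕ) (e : Expr) : Evaluates (.assign (.const d) e) d e.eval :=
  fun m => ⟨_, .assign _ _ m, Function.update_self .., fun _ hj => Function.update_of_ne hj.ne ..⟩

theorem exists_evaluates_family {n : ℕ} {F : Fin n → (ℕ → ℕ) → ℕ} {d : ℕ}
    (local_F : ∀ i m m', (∀ j < d, m' j = m j) → F i m' = F i m)
    (h : ∀ i : Fin n, ∃ p, Evaluates p (d + i) (F i)) :
    ∃ p, ∀ m, ∃ m', Arith p m m' ∧ (∀ i : Fin n, m' (d + i) = F i m) ∧ ∀ j < d, m' j = m j := by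
  choose q hq using h
  suffices ∀ k ≤ n, ∃ p, ∀ m, ∃ m', Arith p m m' ∧
      (∀ i : Fin n, i < k → m' (d + i) = F i m) ∧ ∀ j < d, m' j = m j by
    obtain ⟨p, hp⟩ := this n le_rfl
    exact ⟨p, fun m => (hp m).imp fun _ h => ⟨h.1, fun i => h.2.1 i i.2, h.2.2⟩⟩
  intro k
  induction k with
  | zero =>
    exact fun _ => ⟨.skip, fun m => ⟨m, .skip m, by simp, fun _ _ => rfl⟩⟩
  | succ k ih =>
    intro hk
    obtain ⟨p, hp⟩ := ih (Nat.le_of_succ_le hk)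
    refine ⟨.seq p (q ⟨k, hk⟩), fun m => ?_⟩
    obtain ⟨m₁, hm₁, hval₁, hlow₁⟩ := hp m
    obtain ⟨m₂, hm₂, hval₂, hlow₂⟩ := hq ⟨k, hk⟩ m₁
    refine ⟨m₂, .seq hm₁ hm₂, fun i hi => ?_, fun j hj => ?_⟩
    · obtain hi | hi := Nat.lt_succ_iff_lt_or_eq.1 hi
      · rw [hlow₂ _ (Nat.add_lt_add_left hi d), hval₁ i hi]
      · obtain rfl : i = ⟨k, hk⟩ := Fin.ext hi
        rw [hval₂, local_F _ _ _ hlow₁]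
    · rw [hlow₂ j (by omega), hlow₁ j hj]

/-- The values of the cells with addresses `a`. -/
def cells {n : ℕ} (a : Fin n → ℕ) (m : ℕ → ℕ) : List.Vector ℕ n := List.Vector.ofFn fun i => m (a i)

theorem cells_congr {n d : ℕ} {a : Fin n → ℕ} (ha : ∀ i, a i < d) {m m' : ℕ → ℕ}
    (h : ∀ j < d, m' j = m j) : cells a m' = cells a m :=
  congrArg List.Vector.ofFn (funext fun i => h (a i) (ha i))

theorem cells_cons {n : ℕ} (x : ℕ) (a : Fin n → ℕ) (m : ℕ → ℕ) :
    cells (Fin.cons x a : Fin (n + 1) → ℕ) m = m x ::ᵥ cells a m := rfl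

theorem exists_evaluates_prec {n d : ℕ} {f : List.Vector ℕ n → ℕ} {g : List.Vector ℕ (n + 2) → ℕ}
    {a : Fin (n + 1) → ℕ} (ha : ∀ i, a i < d) {p q : Prog}
    (hp : Evaluates p d fun m => f (cells (Fin.tail a) m))
    (hq : Evaluates q (d + 2) fun m =>
      g (cells (Fin.cons (d + 1) (Fin.cons d (Fin.tail a)) : Fin (n + 2) → ℕ) m)) :
    ∃ p, Evaluates p d fun m => (m (a 0)).rec (f (cells (Fin.tail a) m))
      fun y IH => g (y ::ᵥ IH ::ᵥ cells (Fin.tail a) m) := by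
  refine ⟨.seq p (.seq (.assign (.const (d + 1)) (.const 0))
    (.loop (.sub (.load (.const (a 0))) (.load (.const (d + 1)))) (.seq q
      (.seq (.assign (.const d) (.load (.const (d + 2))))
        (.assign (.const (d + 1)) (.add (.load (.const (d + 1))) (.const 1))))))), fun m => ?_⟩
  let value : ℕ → ℕ := fun k => k.rec (f (cells (Fin.tail a) m))
    fun y IH => g (y ::ᵥ IH ::ᵥ cells (Fin.tail a) m)
  let I : ℕ → (ℕ → ℕ) → Prop := fun k m' => m' d = value k ∧ m' (d + 1) = k ∧ ∀ j < d, m' j = m j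
  obtain ⟨m₁, hm₁, hval₁, hlow₁⟩ := hp m
  have start : I 0 (Function.update m₁ (d + 1) 0) := by
    refine ⟨?_, Function.update_self .., fun j hj => ?_⟩
    · exact (Function.update_of_ne (by omega) ..).trans hval₁
    · rw [Function.update_of_ne (by omega), hlow₁ j hj]
  have step : ∀ k m', k < m (a 0) → I k m' → ∃ m'', Arith (.seq q
      (.seq (.assign (.const d) (.load (.const (d + 2))))
        (.assign (.const (d + 1)) (.add (.load (.const (d + 1))) (.const 1))))) m' m'' ∧
      I (k + 1) m'' := by
    rintro k m' - ⟨hval, hcount, hlow⟩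
    obtain ⟨m₂, hm₂, hval₂, hlow₂⟩ := hq m'
    refine ⟨_, .seq hm₂ (.seq (.assign ..) (.assign ..)), ?_, ?_, fun j hj => ?_⟩
    · have hargs : cells (Fin.tail a) m' = cells (Fin.tail a) m :=
        cells_congr (fun i => ha i.succ) hlow
      simp only [cells_cons, hcount, hval, hargs] at hval₂
      rw [Function.update_of_ne (by simp only [Expr.eval]; omega)]
      exact (Function.update_self ..).trans hval₂
    · simp only [Expr.eval, Function.update_self]
      rw [Function.update_of_ne (by omega), hlow₂ _ (by omega), hcount]
    · simp only [Expr.eval]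
      rw [Function.update_of_ne (by omega), Function.update_of_ne (by omega), hlow₂ j (by omega),
        hlow j hj]
  obtain ⟨m₃, hm₃, hI⟩ := Arith.loop_of_iterate (N := m (a 0))
    (b := .sub (.load (.const (a 0))) (.load (.const (d + 1)))) I
    (fun k m' h => congrArg₂ (· - ·) (h.2.2 _ (ha 0)) h.2.1) step (Nat.zero_le _) start
  exact ⟨m₃, .seq hm₁ (.seq (.assign ..) hm₃), hI.1, hI.2.2⟩

theorem exists_evaluates_of_primrec' {n : ℕ} {f : List.Vector ℕ n → ℕ} (hf : Nat.Primrec' f) :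
    ∀ (a : Fin n → ℕ) (d : ℕ), (∀ i, a i < d) → ∃ p, Evaluates p d fun m => f (cells a m) := by
  induction hf with
  | zero => exact fun _ d _ => ⟨_, .assign d (.const 0)⟩
  | succ => exact fun a d _ => ⟨_, .assign d (.add (.load (.const (a 0))) (.const 1))⟩
  | get i =>
    exact fun a d _ => ⟨.assign (.const d) (.load (.const (a i))), by
      simp only [cells, List.Vector.get_ofFn]
      exact .assign d (.load (.const (a i)))⟩
  | @comp k n f g _ _ ihf ihg =>
    intro a d ha
    obtain ⟨p, hp⟩ := exists_evaluates_family (F := fun i m => g i (cells a m))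
      (fun i _ _ h => congrArg (g i) (cells_congr ha h))
      fun i => ihg i a (d + i) fun j => (ha j).trans_le (Nat.le_add_right ..)
    obtain ⟨q, hq⟩ := ihf (fun i => d + i) (d + n) fun i => Nat.add_lt_add_left i.2 d
    refine ⟨.seq p (.seq q (.assign (.const d) (.load (.const (d + n))))), fun m => ?_⟩
    obtain ⟨m₁, hm₁, hval₁, hlow₁⟩ := hp m
    obtain ⟨m₂, hm₂, hval₂, hlow₂⟩ := hq m₁
    refine ⟨_, .seq hm₁ (.seq hm₂ (.assign ..)), ?_, fun j hj => ?_⟩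
    · simp only [Expr.eval, Function.update_self]
      rw [hval₂]
      exact congrArg f (congrArg List.Vector.ofFn (funext hval₁))
    · simp only [Expr.eval]
      rw [Function.update_of_ne hj.ne, hlow₂ j (by omega), hlow₁ j hj]
  | @prec n f g _ _ ihf ihg =>
    intro a d ha
    obtain ⟨p, hp⟩ := ihf (Fin.tail a) d fun i => ha i.succ
    obtain ⟨q, hq⟩ := ihg (Fin.cons (d + 1) (Fin.cons d (Fin.tail a))) (d + 2) fun i => by
      refine Fin.cases (Nat.lt_succ_self _) (fun i => Fin.cases (by simp) (fun i => ?_) i) i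
      exact (ha i.succ).trans_le (Nat.le_add_right ..)
    obtain ⟨r, hr⟩ := exists_evaluates_prec ha hp hq
    refine ⟨r, ?_⟩
    simpa [cells, List.Vector.ofFn, Fin.tail] using hr

/-- The number cells from this address on are the working memory of arithmetic programs. -/
abbrev scratch : ℕ := 10

/-- `Stores p f dst x y`: the program `p` reads the codes of two arguments from the number cells
`x` and `y` and stores the code of the value of `f` in the cell `dst`. -/
def Stores {α β γ : Type} [Primcodable α] [Primcodable β] [Primcodable γ]
    (p : Prog) (f : α → β → γ) (dst x y : ℕ) : Prop :=
  ∀ m a b, m x = Encodable.encode a → m y = Encodable.encode b → ∃ m', Arith p m m' ∧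
    m' dst = Encodable.encode (f a b) ∧ ∀ j < scratch, j ≠ dst → m' j = m j

section Primrec

variable {α β γ : Type} [Primcodable α] [Primcodable β] [Primcodable γ] {f : α → β → γ}

theorem exists_stores (hf : Primrec₂ f) (dst x y : ℕ) :
    ∃ p, x < scratch → y < scratch → Stores p f dst x y := by
  by_cases hxy : x < scratch ∧ y < scratch
  swap
  · exact ⟨.skip, fun hx hy => absurd ⟨hx, hy⟩ hxy⟩
  let g : ℕ → ℕ → ℕ := fun k l => (Encodable.encode
    ((Encodable.decode (α := α) k).bind fun a => (Encodable.decode (α := β) l).map (f a))).pred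
  have hg : Nat.Primrec' fun v : List.Vector ℕ 2 => g v.head v.tail.head :=
    Nat.Primrec'.prim_iff₂.2 (Primrec.pred.comp₂
      (Primrec.encode.comp₂ (Primrec₂.nat_iff'.1 hf)))
  obtain ⟨p, hp⟩ := exists_evaluates_of_primrec' hg ![x, y] scratch
    (Fin.forall_fin_two.2 hxy)
  refine ⟨.seq p (.assign (.const dst) (.load (.const scratch))), fun _ _ m a b ha hb => ?_⟩
  obtain ⟨m₁, hm₁, hval, hlow⟩ := hp m
  refine ⟨_, .seq hm₁ (.assign ..), ?_, fun j hj hne => ?_⟩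
  · simp only [Expr.eval, Function.update_self]
    rw [hval]
    simp [g, cells, List.Vector.ofFn, ha, hb]
  · exact (Function.update_of_ne hne ..).trans (hlow j hj)

/-- A program for a primitive recursive function of two arguments. -/
noncomputable def primrecProg (hf : Primrec₂ f) (dst x y : ℕ) : Prog :=
  (exists_stores hf dst x y).choose

theorem stores_primrecProg (hf : Primrec₂ f) {dst x y : ℕ} (hx : x < scratch) (hy : y < scratch) :
    Stores (primrecProg hf dst x y) f dst x y :=
  (exists_stores hf dst x y).choose_spec hx hy

end Primrec

section Traps

/-- Remove from `l` the labels with a recorded edge that leaves `l`. -/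
def shrink (es : List (ℕ × ℕ)) (l : List ℕ) : List ℕ :=
  l.filter fun x => ∀ e ∈ es, e.1 = x → e.2 ∈ l

/-- The largest part of `l` that no recorded edge leaves. -/
def trapped (es : List (ℕ × ℕ)) (l : List ℕ) : List ℕ :=
  (shrink es)^[l.length] l

/-- Some label of `l` from which no recorded edges lead out of `l`. -/
def findTrapped (es : List (ℕ × ℕ)) (l : List ℕ) : Option ℕ :=
  (trapped es l).head?

/-- Remove the recorded edges into `x`. -/
def eraseTarget (es : List (ℕ × ℕ)) (x : ℕ) : List (ℕ × ℕ) :=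
  es.filter fun e => e.2 ≠ x

/-- Remove the label `x`. -/
def eraseLabel (l : List ℕ) (x : ℕ) : List ℕ :=
  l.filter fun y => y ≠ x

theorem primrec_eraseTarget : Primrec₂ eraseTarget :=
  PrimrecRel.listFilter (R := fun (e : ℕ × ℕ) x => e.2 ≠ x)
    (PrimrecRel.not (Primrec.eq.comp (Primrec.snd.comp Primrec.fst) Primrec.snd))

theorem primrec_eraseLabel : Primrec₂ eraseLabel :=
  PrimrecRel.listFilter (R := fun (y x : ℕ) => y ≠ x) (PrimrecRel.not Primrec.eq)

theorem primrec_shrink : Primrec₂ shrink := by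
  have mem : PrimrecRel fun (l : List ℕ) (x : ℕ) => x ∈ l :=
    (PrimrecRel.exists_mem_list Primrec.eq).of_eq fun l x => by simp
  have leaves : PrimrecRel fun (e : ℕ × ℕ) (p : ℕ × List ℕ) => e.1 = p.1 ∧ e.2 ∉ p.2 :=
    PrimrecPred.and
      (Primrec.eq.comp (Primrec.fst.comp Primrec.fst) (Primrec.fst.comp Primrec.snd))
      (PrimrecRel.not mem |>.comp (Primrec.snd.comp Primrec.snd) (Primrec.snd.comp Primrec.fst))
  have stays : PrimrecRel fun (x : ℕ) (p : List (ℕ × ℕ) × List ℕ) =>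
      ∀ e ∈ p.1, e.1 = x → e.2 ∈ p.2 :=
    ((PrimrecRel.exists_mem_list leaves).not.comp (Primrec.fst.comp Primrec.snd)
      (Primrec.pair Primrec.fst (Primrec.snd.comp Primrec.snd))).of_eq fun p => by
        simp only [not_exists, not_and, Decidable.not_not]
  exact (PrimrecRel.listFilter stays).comp₂ Primrec₂.right Primrec₂.pair

theorem primrec_findTrapped : Primrec₂ findTrapped :=
  Primrec.list_head?.comp₂ (Primrec.nat_iterate (Primrec.list_length.comp Primrec.snd) Primrec.snd
    (primrec_shrink.comp₂ (Primrec.fst.comp₂ Primrec₂.left) Primrec₂.right)).to₂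

theorem iterate_sublist_of_sublist {α : Type*} {f : List α → List α}
    (hf : ∀ l, (f l).Sublist l) (k : ℕ) (l : List α) : (f^[k] l).Sublist l := by
  induction k with
  | zero => exact .refl l
  | succ k ih => exact Function.iterate_succ_apply' f k l ▸ (hf _).trans ih

theorem iterate_length_fixed_of_sublist {α : Type*} {f : List α → List α}
    (hf : ∀ l, (f l).Sublist l) (l : List α) : f (f^[l.length] l) = f^[l.length] l := by
  suffices ∀ k l, l.length ≤ k → f (f^[k] l) = f^[k] l from this _ l le_rfl
  intro k
  induction k with
  | zero => exact fun l hl => (hf l).eq_of_length_le (hl.trans (Nat.zero_le _))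
  | succ k ih =>
    intro l hl
    by_cases h : (f l).length = l.length
    · rw [Function.iterate_fixed ((hf l).eq_of_length h), (hf l).eq_of_length h]
    · exact ih (f l) (by have := (hf l).length_le; omega)

variable {es : List (ℕ × ℕ)} {l : List ℕ} {x : ℕ}

theorem shrink_sublist (es : List (ℕ × ℕ)) (l : List ℕ) : (shrink es l).Sublist l :=
  List.filter_sublist

theorem mem_shrink : x ∈ shrink es l ↔ x ∈ l ∧ ∀ y, (x, y) ∈ es → y ∈ l := by
  simp only [shrink, List.mem_filter, decide_eq_true_eq]
  exact and_congr_right fun _ =>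
    ⟨fun h y hy => h (x, y) hy rfl, by rintro h ⟨_, y⟩ hy rfl; exact h y hy⟩

theorem trapped_subset : trapped es l ⊆ l :=
  (iterate_sublist_of_sublist (shrink_sublist es) _ l).subset

theorem mem_trapped_of_edge {y : ℕ} (hx : x ∈ trapped es l) (he : (x, y) ∈ es) :
    y ∈ trapped es l := by
  rw [trapped, ← iterate_length_fixed_of_sublist (shrink_sublist es), mem_shrink] at hx
  exact hx.2 y he

theorem induction_of_notMem_trapped {C : ℕ → Prop}
    (step : ∀ x ∈ l, ∀ y, (x, y) ∈ es → (y ∈ l → C y) → C x)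
    (hx : x ∈ l) (hxt : x ∉ trapped es l) : C x := by
  suffices ∀ k, ∀ x ∈ l, x ∉ (shrink es)^[k] l → C x from this _ x hx hxt
  intro k
  induction k with
  | zero => exact fun x hx hxt => absurd hx hxt
  | succ k ih =>
    intro x hx hxk
    by_cases hx' : x ∈ (shrink es)^[k] l
    · rw [Function.iterate_succ_apply', mem_shrink] at hxk
      push Not at hxk
      obtain ⟨y, he, hy⟩ := hxk hx'
      exact step x hx y he fun hyl => ih y hyl hy
    · exact ih x hx hx'

theorem trapped_eq_nil_of_findTrapped (h : findTrapped es l = none) : trapped es l = [] :=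
  List.head?_eq_none_iff.1 h

theorem mem_trapped_of_findTrapped (h : findTrapped es l = some x) : x ∈ trapped es l :=
  List.mem_of_mem_head? h

end Traps

section Correctness

/-- The part of a configuration that matters for programs which write no sets of edges. A cell that
stores no set is identified with one that stores the empty set. -/
structure Conf (V : Type*) where
  num : ℕ → ℕ
  vs : ℕ → Set V
  ops : ℕ

/-- The parameters of an execution: the choices of `Pick`, the number of vertex sets that encode
the vertex labels in binary, and the set of edges in the edge-set cell `0`. -/
structure Env (V : Type*) where
  ρ : Picker V
  size : ℕ
  E : Set (V × V)

/-- The vertex-set cells from this address on hold the binary digits of the labels. -/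
@[simp] abbrev digitBase : ℕ := 9

variable {V : Type*}

/-- The number of vertex-set cells in use. -/
def Env.bound (M : Env V) : ℕ := digitBase + M.size

/-- The relevant part of a configuration. -/
def State.conf (s : State V) : Conf V := ⟨s.num, fun i => (s.vset i).getD ∅, s.ops⟩

namespace Conf

/-- Write a number. -/
def setN (c : Conf V) (i k : ℕ) : Conf V := { c with num := Function.update c.num i k }

/-- Write a set of vertices. -/
def setV (c : Conf V) (i : ℕ) (S : Set V) : Conf V := { c with vs := Function.update c.vs i S }

/-- Count `k` further symbolic operations. -/
def tick (c : Conf V) (k : ℕ) : Conf V := { c with ops := c.ops + k }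

variable (c : Conf V) (i k : ℕ) (S : Set V)

@[simp] theorem num_setN : (c.setN i k).num = Function.update c.num i k := rfl
@[simp] theorem vs_setN : (c.setN i k).vs = c.vs := rfl
@[simp] theorem ops_setN : (c.setN i k).ops = c.ops := rfl
@[simp] theorem num_setV : (c.setV i S).num = c.num := rfl
@[simp] theorem vs_setV : (c.setV i S).vs = Function.update c.vs i S := rfl
@[simp] theorem ops_setV : (c.setV i S).ops = c.ops := rfl
@[simp] theorem num_tick : (c.tick k).num = c.num := rfl
@[simp] theorem vs_tick : (c.tick k).vs = c.vs := rfl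
@[simp] theorem ops_tick : (c.tick k).ops = c.ops + k := rfl

end Conf

/-- The sets of vertices are stored below the bound, and only one set of edges is stored. -/
structure Env.Fits (M : Env V) (s : State V) : Prop where
  vset : ∀ i, M.bound ≤ i → s.vset i = none
  eset : ∀ i, i ≠ 0 → s.eset i = none
  edges : s.eset 0 = some M.E
  peak : s.peak ≤ (M.bound + 1 : ℕ)

theorem stored_le {B : ℕ} {s : State V} (hv : ∀ i, B ≤ i → s.vset i = none)
    (he : ∀ i, i ≠ 0 → s.eset i = none) : s.stored ≤ (B + 1 : ℕ) := by
  have hvset : {i | s.vset i ≠ none}.encard ≤ B := by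
    refine (Set.encard_le_encard (t := (Finset.range B : Set ℕ)) fun i hi => ?_).trans ?_
    · by_contra h
      exact hi (hv i (by simpa using h))
    · rw [Set.encard_coe_eq_coe_finsetCard, Finset.card_range]
  have heset : {i | s.eset i ≠ none}.encard ≤ 1 :=
    (Set.encard_le_encard (t := {0}) fun i (hi : s.eset i ≠ none) =>
      by_contra fun h => hi (he i h)).trans (Set.encard_singleton 0).le
  calc s.stored ≤ B + 1 := add_le_add hvset heset
    _ = ((B + 1 : ℕ) : ℕ∞) := by norm_cast

namespace Env.Fits

variable {M : Env V} {s : State V}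

theorem putN (h : M.Fits s) (a : Expr) (k : ℕ) : M.Fits (s.putN a k) :=
  ⟨h.vset, h.eset, h.edges, h.peak⟩

theorem putV (h : M.Fits s) (a : Expr) (S : Option (Set V)) (ha : s.val a < M.bound) :
    M.Fits (s.putV a S) :=
  ⟨fun i hi => (Function.update_of_ne (ha.trans_le hi).ne' ..).trans (h.vset i hi),
    h.eset, h.edges, h.peak⟩

theorem track (h : M.Fits s) (k : ℕ) : M.Fits { s.track with ops := k } :=
  ⟨h.vset, h.eset, h.edges, max_le h.peak (stored_le h.vset h.eset)⟩

end Env.Fits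

theorem conf_putV (s : State V) (a : Expr) (S : Set V) :
    (s.putV a (some S)).conf = s.conf.setV (s.val a) S :=
  congrArg (Conf.mk s.num · s.ops) (funext fun i =>
    Function.apply_update (fun _ (o : Option (Set V)) => o.getD ∅) s.vset (s.val a) (some S) i)

infixr:67 ";;" => Prog.seq

/-- The number in the cell `i`. -/
abbrev cell (i : ℕ) : Expr := .load (.const i)

namespace Prog

abbrev set (i : ℕ) (e : Expr) : Prog := .assign (.const i) e
abbrev union (d x y : ℕ) : Prog := .op (.vertexOp .union (.const d) (.const x) (.const y))
abbrev inter (d x y : ℕ) : Prog := .op (.vertexOp .inter (.const d) (.const x) (.const y))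
abbrev diff (d x y : ℕ) : Prog := .op (.vertexOp .diff (.const d) (.const x) (.const y))
abbrev pre (d x : ℕ) : Prog := .op (.pre (.const d) (.const 0) (.const x))
abbrev post (d x : ℕ) : Prog := .op (.post (.const d) (.const 0) (.const x))
abbrev pick (d x : ℕ) : Prog := .op (.pick (.const d) (.const x))
abbrev subset (d x y : ℕ) : Prog := .op (.vertexSubset (.const d) (.const x) (.const y))
abbrev card (d x : ℕ) : Prog := .op (.card (.const d) (.const x))

end Prog

/-- Total correctness: the program `p`, started in `c`, halts in a configuration that satisfies
`Q`. -/
def Run (M : Env V) (p : Prog) (c : Conf V) (Q : Conf V → Prop) : Prop :=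
  ∀ s, M.Fits s → s.conf = c → ∃ t, Exec M.ρ p s t ∧ M.Fits t ∧ Q t.conf

namespace Run

variable {M : Env V} {c : Conf V} {p q : Prog} {Q : Conf V → Prop}

theorem mono {Q' : Conf V → Prop} (h : Run M p c Q) (hQ : ∀ c', Q c' → Q' c') :
    Run M p c Q' := fun s hs hc =>
  (h s hs hc).imp fun _ ⟨hexec, hfits, hpost⟩ => ⟨hexec, hfits, hQ _ hpost⟩

theorem skip (h : Q c) : Run M .skip c Q := fun s hs hc => ⟨s, .skip s, hs, hc ▸ h⟩

theorem seq (h : Run M p c fun c' => Run M q c' Q) : Run M (.seq p q) c Q := fun s hs hc =>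
  let ⟨t, hp, ht, hq⟩ := h s hs hc
  let ⟨u, hq, hu, hQ⟩ := hq t ht rfl
  ⟨u, .seq hp hq, hu, hQ⟩

theorem ite {b : Expr} (hp : b.eval c.num ≠ 0 → Run M p c Q)
    (hq : b.eval c.num = 0 → Run M q c Q) : Run M (.ite b p q) c Q := by
  rintro s hs rfl
  by_cases hb : b.eval s.num = 0
  · exact (hq hb s hs rfl).imp fun t ht => ⟨.ite_false hb ht.1, ht.2⟩
  · exact (hp hb s hs rfl).imp fun t ht => ⟨.ite_true hb ht.1, ht.2⟩

theorem loop {b : Expr} (I : Conf V → Prop) (m : Conf V → ℕ)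
    (step : ∀ c, I c → b.eval c.num ≠ 0 → Run M p c fun c' => I c' ∧ m c' < m c)
    (done : ∀ c, I c → b.eval c.num = 0 → Q c) (hc : I c) : Run M (.loop b p) c Q := by
  induction hk : m c using Nat.strong_induction_on generalizing c with
  | _ k ih =>
    rintro s hs rfl
    by_cases hb : b.eval s.num = 0
    · exact ⟨s, .loop_done hb, hs, done _ hc hb⟩
    · obtain ⟨t, hbody, ht, hI, hlt⟩ := step _ hc hb s hs rfl
      obtain ⟨u, hrest, hu⟩ := ih _ (hk ▸ hlt) hI rfl t ht rfl
      exact ⟨u, .loop_step hb hbody hrest, hu⟩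

theorem arith (h : ∃ m, Arith p c.num m ∧ Q { c with num := m }) : Run M p c Q := by
  rintro s hs rfl
  obtain ⟨m, hp, hQ⟩ := h
  exact ⟨_, hp.exec M.ρ s rfl, ⟨hs.vset, hs.eset, hs.edges, hs.peak⟩, hQ⟩

theorem set {i : ℕ} {e : Expr} (h : Q (c.setN i (e.eval c.num))) : Run M (.set i e) c Q :=
  arith ⟨_, .assign .., h⟩

theorem op_putV {o : Op} {a : Expr} {f : State V → Set V}
    (effect : ∀ s : State V, s.effect M.ρ o = s.putV a (some (f s)))
    (ha : a.eval c.num < M.bound)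
    (h : ∀ s, M.Fits s → s.conf = c → Q ((c.setV (a.eval c.num) (f s)).tick 1)) :
    Run M (.op o) c Q := by
  rintro s hs rfl
  refine ⟨_, .op o s, ?_, ?_⟩
  · rw [State.perform, effect]
    exact (hs.putV a _ ha).track _
  · have hconf : (s.perform M.ρ o).conf = (s.conf.setV (s.val a) (f s)).tick 1 := by
      rw [State.perform, effect, ← conf_putV]
      rfl
    exact hconf ▸ h s hs rfl

theorem op_putN {o : Op} {a : Expr} {f : State V → ℕ}
    (effect : ∀ s : State V, s.effect M.ρ o = s.putN a (f s))
    (h : ∀ s, s.conf = c → Q ((c.setN (a.eval c.num) (f s)).tick 1)) : Run M (.op o) c Q := by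
  rintro s hs rfl
  refine ⟨_, .op o s, ?_, ?_⟩
  · rw [State.perform, effect]
    exact (hs.putN a _).track _
  · rw [State.perform, effect]
    exact h s rfl

theorem vertexOp {o : SetOp} {d x y : Expr} (hd : d.eval c.num < M.bound)
    (h : Q ((c.setV (d.eval c.num)
      (o.apply (c.vs (x.eval c.num)) (c.vs (y.eval c.num)))).tick 1)) :
    Run M (.op (.vertexOp o d x y)) c Q :=
  op_putV (fun _ => rfl) hd fun s _ hs => by subst hs; exact h

open Classical in
theorem vertexSubset {d x y : Expr}
    (h : Q ((c.setN (d.eval c.num)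
      (if c.vs (x.eval c.num) ⊆ c.vs (y.eval c.num) then 1 else 0)).tick 1)) :
    Run M (.op (.vertexSubset d x y)) c Q :=
  op_putN (fun _ => rfl) fun s hs => by subst hs; exact h

section ConstantAddresses

variable {d x y : ℕ}

theorem union (h : Q ((c.setV d (c.vs x ∪ c.vs y)).tick 1))
    (hd : d < M.bound := by simp +arith [Env.bound]) : Run M (.union d x y) c Q :=
  vertexOp hd h

theorem inter (h : Q ((c.setV d (c.vs x ∩ c.vs y)).tick 1))
    (hd : d < M.bound := by simp +arith [Env.bound]) : Run M (.inter d x y) c Q :=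
  vertexOp hd h

theorem diff (h : Q ((c.setV d (c.vs x \ c.vs y)).tick 1))
    (hd : d < M.bound := by simp +arith [Env.bound]) : Run M (.diff d x y) c Q :=
  vertexOp hd h

theorem pre (h : Q ((c.setV d {v | ∃ w ∈ c.vs x, (v, w) ∈ M.E}).tick 1))
    (hd : d < M.bound := by simp +arith [Env.bound]) : Run M (.pre d x) c Q :=
  op_putV (fun _ => rfl) hd fun s hf hs => by
    have hE : s.getE (.const 0) = M.E := by simp [State.getE, State.val, Expr.eval, hf.edges]
    rw [hE]; subst hs; exact h

theorem post (h : Q ((c.setV d {w | ∃ v ∈ c.vs x, (v, w) ∈ M.E}).tick 1))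
    (hd : d < M.bound := by simp +arith [Env.bound]) : Run M (.post d x) c Q :=
  op_putV (fun _ => rfl) hd fun s hf hs => by
    have hE : s.getE (.const 0) = M.E := by simp [State.getE, State.val, Expr.eval, hf.edges]
    rw [hE]; subst hs; exact h

theorem pick (hx : (c.vs x).Nonempty) (h : ∀ v ∈ c.vs x, Q ((c.setV d {v}).tick 1))
    (hd : d < M.bound) : Run M (.pick d x) c Q :=
  op_putV (fun _ => rfl) hd fun s _ hs => by
    subst hs
    have hv := M.ρ.choose_mem s.ops _ hx
    have hsingle : {v | v ∈ s.getV (.const x) ∧ v = M.ρ.choose s.ops (s.getV (.const x))} =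
        {M.ρ.choose s.ops (s.getV (.const x))} :=
      Set.ext fun v => and_iff_right_of_imp fun hvx => hvx ▸ hv
    rw [hsingle]
    exact h _ hv

open Classical in
theorem subset (h : Q ((c.setN d (if c.vs x ⊆ c.vs y then 1 else 0)).tick 1)) :
    Run M (.subset d x y) c Q :=
  vertexSubset h

theorem card (h : Q ((c.setN d (c.vs x).ncard).tick 1)) : Run M (.card d x) c Q :=
  op_putN (fun _ => rfl) fun s hs => by subst hs; exact h

end ConstantAddresses

theorem primrec {α β γ : Type} [Primcodable α] [Primcodable β] [Primcodable γ] {f : α → β → γ}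
    (hf : Primrec₂ f) {dst x y : ℕ} {a : α} {b : β}
    (ha : c.num x = Encodable.encode a) (hb : c.num y = Encodable.encode b)
    (h : ∀ m : ℕ → ℕ, m dst = Encodable.encode (f a b) →
      (∀ j < scratch, j ≠ dst → m j = c.num j) → Q { c with num := m })
    (hx : x < scratch := by decide) (hy : y < scratch := by decide) :
    Run M (primrecProg hf dst x y) c Q :=
  let ⟨m, hp, hval, hlow⟩ := stores_primrecProg hf hx hy c.num a b ha hb
  arith ⟨m, hp, h m hval hlow⟩

end Run

end Correctness

section Registers

/-- The trade-off parameter. -/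
@[simp] abbrev rParam : ℕ := 0
/-- The number of binary digits of the labels. -/
@[simp] abbrev rBits : ℕ := 1
/-- The recorded edges, a list of pairs of labels. -/
@[simp] abbrev rEdges : ℕ := 2
/-- The labels of the candidates whose edges are recorded. -/
@[simp] abbrev rRead : ℕ := 3
/-- The condition of the loop of `prune` and of the main loop. -/
@[simp] abbrev rFlag : ℕ := 4
/-- The condition of the loop of `reachTarget`. -/
@[simp] abbrev rGrow : ℕ := 5
/-- The number of candidates that succeed the current vertex and then, if its edges are recorded,
its label. -/
@[simp] abbrev rTail : ℕ := 6
/-- The label of the current vertex. -/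
@[simp] abbrev rLabel : ℕ := 7
/-- The position of a binary digit. -/
@[simp] abbrev rDigit : ℕ := 8
/-- The size of the set that a loop consumes, and the outcome of a test. -/
@[simp] abbrev rCount : ℕ := 9

/-- The candidates. -/
@[simp] abbrev vCand : ℕ := 0
/-- The candidates whose edges are not recorded. -/
@[simp] abbrev vUnread : ℕ := 1
/-- The random vertices outside the target. -/
@[simp] abbrev vRandom : ℕ := 2
/-- The target. -/
@[simp] abbrev vTarget : ℕ := 3
/-- The candidates that are to be removed. -/
@[simp] abbrev vPending : ℕ := 4
/-- The set that a loop consumes. -/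
@[simp] abbrev vQueue : ℕ := 5
/-- The current vertex. -/
@[simp] abbrev vCur : ℕ := 6
/-- The neighbours of the current vertex. -/
@[simp] abbrev vNbrs : ℕ := 7
/-- The current neighbour. -/
@[simp] abbrev vNbr : ℕ := 8

end Registers

section Loops

/-- Run the body once for every position of a binary digit. -/
def forDigits (body : Prog) : Prog :=
  .set rDigit (.const 0) ;;
  .loop (.sub (cell rBits) (cell rDigit))
    (body ;; .set rDigit (.add (cell rDigit) (.const 1)))

/-- Run the body as long as the set in the cell `z` is non-empty, each time with a vertex that is
moved from this set to the cell `x`. -/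
def whileNonempty (z x : ℕ) (body : Prog) : Prog :=
  .card rCount z ;;
  .loop (cell rCount) (.pick x z ;; .diff z z x ;; body ;; .card rCount z)

variable {V : Type*} {M : Env V} {c : Conf V} {body : Prog} {Q : Conf V → Prop}

theorem Run.forDigits (I : ℕ → Conf V → Prop) (bits : ∀ k c, I k c → c.num rBits = M.size)
    (start : I 0 (c.setN rDigit 0))
    (step : ∀ k c, k < M.size → c.num rDigit = k → I k c → Run M body c fun c' =>
      c'.num rDigit = k ∧ I (k + 1) (c'.setN rDigit (k + 1)))
    (done : ∀ c, I M.size c → Q c) : Run M (forDigits body) c Q := by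
  refine .seq <| .set <| .loop (fun c => c.num rDigit ≤ M.size ∧ I (c.num rDigit) c)
    (fun c => M.size - c.num rDigit) ?_ ?_ ⟨by simp [Expr.eval], by simpa [Expr.eval] using start⟩
  · rintro c ⟨hle, hI⟩ hb
    simp only [Expr.eval, bits _ c hI] at hb
    refine .seq <| (step _ c (by omega) rfl hI).mono fun c' ⟨hdigit, hI'⟩ => .set ?_
    simp only [Expr.eval, hdigit, Conf.num_setN, Function.update_self]
    exact ⟨⟨by omega, hI'⟩, by omega⟩
  · rintro c ⟨hle, hI⟩ hb
    simp only [Expr.eval, bits _ c hI] at hb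
    exact done c (hle.antisymm (by omega) ▸ hI)

theorem Run.whileNonempty [Finite V] {z x : ℕ} (I : Conf V → Prop) (m : Conf V → ℕ)
    (start : I ((c.setN rCount (c.vs z).ncard).tick 1))
    (step : ∀ c v, I c → v ∈ c.vs z →
      Run M body (((c.setV x {v}).setV z (c.vs z \ {v})).tick 2) fun c' =>
        I ((c'.setN rCount (c'.vs z).ncard).tick 1) ∧
          m ((c'.setN rCount (c'.vs z).ncard).tick 1) < m c)
    (done : ∀ c, I c → c.vs z = ∅ → Q c)
    (hx : x < M.bound := by simp +arith [Env.bound])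
    (hz : z < M.bound := by simp +arith [Env.bound])
    (hzx : z ≠ x := by decide) : Run M (whileNonempty z x body) c Q := by
  refine .seq <| .card <| .loop (fun c => c.num rCount = (c.vs z).ncard ∧ I c) m ?_ ?_
    ⟨by simp, start⟩
  · rintro c ⟨hcount, hI⟩ hb
    refine .seq <| .pick (Set.nonempty_of_ncard_ne_zero (hcount ▸ hb))
      (fun v hv => .seq <| .diff ?_ hz) hx
    have hconf : (((c.setV x {v}).tick 1).setV z (((c.setV x {v}).tick 1).vs z \
        ((c.setV x {v}).tick 1).vs x)).tick 1 =
        ((c.setV x {v}).setV z (c.vs z \ {v})).tick 2 := by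
      simp [Conf.setV, Conf.tick, Function.update_of_ne hzx]
    rw [hconf]
    exact .seq <| (step c v hI hv).mono fun c' ⟨hI', hlt⟩ => .card ⟨⟨by simp, hI'⟩, hlt⟩
  · rintro c ⟨hcount, hI⟩ hb
    exact done c hI ((Set.ncard_eq_zero (Set.toFinite _)).1 (hcount ▸ hb))

end Loops

section Memory

variable {V : Type*}

/-- An execution for the reachability objective `T`: besides the environment, the trade-off
parameter `p`, the set `N` of random vertices outside `T`, the winning region `W`, which is
characterized without probabilities, and binary labels of the vertices. -/
structure Task (V : Type*) extends Env V where
  p : ℕ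
  T : Set V
  N : Set V
  W : Set V
  lab : V → ℕ
  target_subset : T ⊆ W
  closed : ∀ v ∈ W ∩ N, ∀ w, (v, w) ∈ E → w ∈ W
  leads : ∀ v ∈ W, Leads E W T v
  maximal : ∀ A, (∀ v ∈ A ∩ N, ∀ w, (v, w) ∈ E → w ∈ A) → (∀ v ∈ A, Leads E A T v) → A ⊆ W
  lab_injective : lab.Injective
  lab_lt : ∀ v, lab v < 2 ^ size

/-- The layout of the memory: `A` is the set of candidates, `U` the set of those whose edges are
not recorded, `es` the list of recorded edges, and `rs` the list of the labels in `A \ U`. -/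
structure Memory (D : Task V) (A U : Set V) (es : List (ℕ × ℕ)) (rs : List ℕ) (c : Conf V) :
    Prop where
  param : c.num rParam = D.p
  bits : c.num rBits = D.size
  edges : c.num rEdges = Encodable.encode es
  read : c.num rRead = Encodable.encode rs
  cand : c.vs vCand = A
  unread : c.vs vUnread = U
  random : c.vs vRandom = D.N
  target : c.vs vTarget = D.T
  digits : ∀ i < D.size, c.vs (digitBase + i) = {v | D.lab v / 2 ^ i % 2 = 1}

/-- The records are correct: `rs` lists the labels of `A \ U`, which contains no targets, every
recorded edge with a tail in `A` is an edge within `A`, and every edge within `A` with a tail in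
`A \ U` is recorded. -/
structure Records (D : Task V) (A U : Set V) (es : List (ℕ × ℕ)) (rs : List ℕ) : Prop where
  unread_subset : U ⊆ A
  target_subset : D.T ⊆ U
  mem_read : ∀ x, x ∈ rs ↔ ∃ v ∈ A \ U, D.lab v = x
  sound : ∀ u ∈ A, ∀ y, (D.lab u, y) ∈ es → ∃ w ∈ A, (u, w) ∈ D.E ∧ D.lab w = y
  complete : ∀ u ∈ A \ U, ∀ w ∈ A, (u, w) ∈ D.E → (D.lab u, D.lab w) ∈ es

variable {D : Task V} {A U : Set V} {es : List (ℕ × ℕ)} {rs : List ℕ} {c c' : Conf V}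

namespace Memory

theorem congr (h : Memory D A U es rs c) (hnum : ∀ i ≤ rRead, c'.num i = c.num i)
    (hvs : ∀ i, i ≤ vTarget ∨ digitBase ≤ i → c'.vs i = c.vs i) : Memory D A U es rs c' where
  param := (hnum _ (by simp)).trans h.param
  bits := (hnum _ (by simp)).trans h.bits
  edges := (hnum _ (by simp)).trans h.edges
  read := (hnum _ (by simp)).trans h.read
  cand := (hvs _ (by simp)).trans h.cand
  unread := (hvs _ (by simp)).trans h.unread
  random := (hvs _ (by simp)).trans h.random
  target := (hvs _ (by simp)).trans h.target
  digits i hi := (hvs _ (by simp)).trans (h.digits i hi)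

theorem tick (h : Memory D A U es rs c) (k : ℕ) : Memory D A U es rs (c.tick k) :=
  h.congr (fun _ _ => rfl) fun _ _ => rfl

theorem setN (h : Memory D A U es rs c) {i : ℕ} (k : ℕ) (hi : rRead < i := by simp) :
    Memory D A U es rs (c.setN i k) :=
  h.congr (fun _ hj => Function.update_of_ne (hj.trans_lt hi).ne ..) fun _ _ => rfl

theorem setV (h : Memory D A U es rs c) {i : ℕ} (S : Set V) (hi : vTarget < i := by simp)
    (hi' : i < digitBase := by simp) : Memory D A U es rs (c.setV i S) :=
  h.congr (fun _ _ => rfl) fun _ hj => Function.update_of_ne (by omega) ..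

end Memory

namespace Records

theorem remove (h : Records D A U es rs) {v : V} (hv : v ∉ D.T) :
    Records D (A \ {v}) (U \ {v}) (eraseTarget es (D.lab v)) (eraseLabel rs (D.lab v)) where
  unread_subset := Set.sdiff_subset_sdiff_left h.unread_subset
  target_subset u hu := ⟨h.target_subset hu, fun huv => hv (huv ▸ hu)⟩
  mem_read x := by
    simp only [eraseLabel, List.mem_filter, h.mem_read, decide_eq_true_eq]
    constructor
    · rintro ⟨⟨u, hu, rfl⟩, hne⟩
      have huv : u ≠ v := fun h => hne (h ▸ rfl)
      exact ⟨u, ⟨⟨hu.1, huv⟩, fun h => hu.2 h.1⟩, rfl⟩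
    · rintro ⟨u, hu, rfl⟩
      exact ⟨⟨u, ⟨hu.1.1, fun h => hu.2 ⟨h, hu.1.2⟩⟩, rfl⟩, D.lab_injective.ne hu.1.2⟩
  sound u hu y he := by
    simp only [eraseTarget, List.mem_filter, decide_eq_true_eq] at he
    obtain ⟨w, hw, huw, rfl⟩ := h.sound u hu.1 y he.1
    exact ⟨w, ⟨hw, fun h => he.2 (h ▸ rfl)⟩, huw, rfl⟩
  complete u hu w hw huw := by
    simp only [eraseTarget, List.mem_filter, decide_eq_true_eq]
    exact ⟨h.complete u ⟨hu.1.1, fun h => hu.2 ⟨h, hu.1.2⟩⟩ w hw.1 huw,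
      D.lab_injective.ne hw.2⟩

theorem read (h : Records D A U es rs) {v : V} (hv : v ∈ U \ D.T) {es' : List (ℕ × ℕ)}
    (hes : ∀ e, e ∈ es' ↔ e ∈ es ∨ ∃ w ∈ A, (v, w) ∈ D.E ∧ e = (D.lab v, D.lab w)) :
    Records D A (U \ {v}) es' (D.lab v :: rs) where
  unread_subset := Set.sdiff_subset.trans h.unread_subset
  target_subset u hu := ⟨h.target_subset hu, fun huv => hv.2 (huv ▸ hu)⟩
  mem_read x := by
    rw [List.mem_cons, h.mem_read]
    constructor
    · rintro (rfl | ⟨u, hu, rfl⟩)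
      · exact ⟨v, ⟨h.unread_subset hv.1, fun h => h.2 rfl⟩, rfl⟩
      · exact ⟨u, ⟨hu.1, fun h => hu.2 h.1⟩, rfl⟩
    · rintro ⟨u, hu, rfl⟩
      by_cases huv : u = v
      · exact .inl (huv ▸ rfl)
      · exact .inr ⟨u, ⟨hu.1, fun h => hu.2 ⟨h, huv⟩⟩, rfl⟩
  sound u hu y he := by
    obtain he | ⟨w, hw, hvw, he⟩ := (hes _).1 he
    · exact h.sound u hu y he
    · obtain ⟨hlab, rfl⟩ := Prod.mk.inj he
      exact ⟨w, hw, D.lab_injective hlab ▸ hvw, rfl⟩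
  complete u hu w hw huw := by
    by_cases huv : u = v
    · exact (hes _).2 (.inr ⟨w, hw, huv ▸ huw, huv ▸ rfl⟩)
    · exact (hes _).2 (.inl (h.complete u ⟨hu.1, fun h => hu.2 ⟨h, huv⟩⟩ w hw huw))

end Records

/-- The memory holds the candidates `A`, the candidates `U` with unrecorded edges, and correct
records. -/
def Holds (D : Task V) (A U : Set V) (c : Conf V) : Prop :=
  ∃ es rs, Memory D A U es rs c ∧ Records D A U es rs

namespace Holds

theorem imp (h : Holds D A U c)
    (hcc' : ∀ es rs, Memory D A U es rs c → Memory D A U es rs c') : Holds D A U c' :=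
  let ⟨es, rs, hmem, hrec⟩ := h
  ⟨es, rs, hcc' es rs hmem, hrec⟩

theorem cand (h : Holds D A U c) : c.vs vCand = A :=
  let ⟨_, _, hmem, _⟩ := h
  hmem.cand

theorem unread_subset (h : Holds D A U c) : U ⊆ A :=
  let ⟨_, _, _, hrec⟩ := h
  hrec.unread_subset

end Holds

end Memory

section Labels

/-- The address of the set of the vertices whose label has a `1` at the current position. -/
abbrev digitCell : Expr := .add (.const digitBase) (cell rDigit)

/-- Store the label of the vertex in the cell `x` in `rLabel`. -/
def labelProg (x : ℕ) : Prog :=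
  .set rLabel (.const 0) ;;
  forDigits
    (.op (.vertexSubset (.const rCount) (.const x) digitCell) ;;
    .set rLabel (.add (cell rLabel) (.mul (.pow (.const 2) (cell rDigit)) (cell rCount))))

/-- Store the candidate whose label is in `rLabel` in `vPending`. -/
def vertexProg : Prog :=
  .inter vPending vCand vCand ;;
  forDigits
    (.ite (.mod (.div (cell rLabel) (.pow (.const 2) (cell rDigit))) (.const 2))
      (.op (.vertexOp .inter (.const vPending) (.const vPending) digitCell))
      (.op (.vertexOp .diff (.const vPending) (.const vPending) digitCell)))

variable {V : Type*} {D : Task V} {A U : Set V} {es : List (ℕ × ℕ)} {rs : List ℕ} {c : Conf V}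

theorem mod_two_pow_succ_eq_iff {a b k : ℕ} :
    a % 2 ^ (k + 1) = b % 2 ^ (k + 1) ↔
      a % 2 ^ k = b % 2 ^ k ∧ a / 2 ^ k % 2 = b / 2 ^ k % 2 := by
  have ha := Nat.mod_lt a (Nat.two_pow_pos k)
  have hb := Nat.mod_lt b (Nat.two_pow_pos k)
  rw [Nat.mod_pow_succ, Nat.mod_pow_succ]
  rcases Nat.mod_two_eq_zero_or_one (a / 2 ^ k) with ha' | ha' <;>
    rcases Nat.mod_two_eq_zero_or_one (b / 2 ^ k) with hb' | hb' <;>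
    simp only [ha', hb'] <;> grind

theorem Run.label (h : Memory D A U es rs c) {x : ℕ} {v : V} (hx : c.vs x = {v}) :
    Run D.toEnv (labelProg x) c fun c' => c'.vs = c.vs ∧ (∀ i < rLabel, c'.num i = c.num i) ∧
      c'.num rLabel = D.lab v ∧ c'.ops = c.ops + D.size := by
  refine .seq <| .set <| .forDigits (fun k c' => c'.vs = c.vs ∧
    (∀ i < rLabel, c'.num i = c.num i) ∧ c'.num rLabel = D.lab v % 2 ^ k ∧ c'.ops = c.ops + k)
    (fun k c' hc' => (hc'.2.1 _ (by simp)).trans h.bits) ?_ ?_ ?_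
  · simp only [Conf.setN, Expr.eval, Function.update_apply]
    grind
  · rintro k c' hk hdigit ⟨hvs, hnum, hlabel, hops⟩
    have htest : c'.vs x ⊆ c'.vs (digitBase + k) ↔ D.lab v / 2 ^ k % 2 = 1 := by
      rw [hvs, hx, h.digits k hk, Set.singleton_subset_iff, Set.mem_ofPred_eq]
    have hbit : D.lab v % 2 ^ (k + 1) = D.lab v % 2 ^ k +
        if D.lab v / 2 ^ k % 2 = 1 then 2 ^ k else 0 := by
      rw [Nat.mod_pow_succ]
      rcases Nat.mod_two_eq_zero_or_one (D.lab v / 2 ^ k) with hd | hd <;> simp [hd]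
    refine .seq <| .vertexSubset <| .set ?_
    simp only [Expr.eval, hdigit, htest, Conf.setN, Conf.tick, Function.update_apply]
    grind
  · rintro c' ⟨hvs, hnum, hlabel, hops⟩
    exact ⟨hvs, hnum, hlabel.trans (Nat.mod_eq_of_lt (D.lab_lt v)), hops⟩

theorem Run.vertex (h : Memory D A U es rs c) (hlt : c.num rLabel < 2 ^ D.size) :
    Run D.toEnv vertexProg c fun c' => (∀ i < rDigit, c'.num i = c.num i) ∧
      (∀ i, i ≠ vPending → c'.vs i = c.vs i) ∧
      c'.vs vPending = {w ∈ A | D.lab w = c.num rLabel} ∧ c'.ops = c.ops + (D.size + 1) := by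
  refine .seq <| .inter <| .forDigits (fun k c' => (∀ i < rDigit, c'.num i = c.num i) ∧
    (∀ i, i ≠ vPending → c'.vs i = c.vs i) ∧
    c'.vs vPending = {w ∈ A | D.lab w % 2 ^ k = c.num rLabel % 2 ^ k} ∧ c'.ops = c.ops + (k + 1))
    (fun k c' hc' => (hc'.1 _ (by simp)).trans h.bits) ?_ ?_ ?_
  · simp only [Conf.setN, Conf.setV, Conf.tick, Function.update_apply, pow_zero, Nat.mod_one,
      h.cand]
    grind
  · rintro k c' hk hdigit ⟨hnum, hvs, hpending, hops⟩
    have hdigits : c'.vs (digitBase + k) = {w | D.lab w / 2 ^ k % 2 = 1} :=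
      (hvs _ (by simp +arith)).trans (h.digits k hk)
    refine .ite (fun hb => .vertexOp (by simp +arith [Expr.eval, Env.bound]) ?_)
      (fun hb => .vertexOp (by simp +arith [Expr.eval, Env.bound]) ?_)
    all_goals
      have hlabel : c'.num rLabel = c.num rLabel := hnum _ (by simp)
      simp only [Expr.eval, hlabel, hdigit, SetOp.apply, hpending, hdigits] at hb ⊢
      simp only [Conf.setN, Conf.setV, Conf.tick, Function.update_apply, mod_two_pow_succ_eq_iff]
      refine ⟨hdigit, by grind, by grind, ?_, by omega⟩
      ext w
      simp only [if_true, Set.mem_inter_iff, Set.mem_sdiff, Set.mem_ofPred_eq]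
      grind
  · rintro c' ⟨hnum, hvs, hpending, hops⟩
    refine ⟨hnum, hvs, ?_, hops⟩
    simpa only [Nat.mod_eq_of_lt (D.lab_lt _), Nat.mod_eq_of_lt hlt] using hpending

end Labels

section Removal

/-- No vertex of the winning region `W` has been removed from the candidates `A` or is about to be,
as one of the vertices in `Z`, and the random candidates with a removed successor are in `Z`. -/
structure Candidates {V : Type*} (D : Task V) (A Z : Set V) : Prop where
  winning_subset : D.W ⊆ A \ Z
  pending_subset : Z ⊆ A
  closed : ∀ u ∈ (A \ Z) ∩ D.N, ∀ w, (u, w) ∈ D.E → w ∈ A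

/-- Remove the candidate in `vCur`, and add its random predecessors to `vPending`. -/
noncomputable def removeProg : Prog :=
  labelProg vCur ;;
  primrecProg primrec_eraseTarget rEdges rEdges rLabel ;;
  primrecProg primrec_eraseLabel rRead rRead rLabel ;;
  .diff vCand vCand vCur ;;
  .diff vUnread vUnread vCur ;;
  .pre vCur vCur ;;
  .inter vCur vCur vRandom ;;
  .inter vCur vCur vCand ;;
  .union vPending vPending vCur

/-- Remove the candidates in `vPending` and, repeatedly, the random candidates with a removed
successor. -/
noncomputable def removePending : Prog := whileNonempty vPending vCur removeProg

variable {V : Type*} {D : Task V} {A U Z : Set V} {c : Conf V}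

theorem Candidates.remove (h : Candidates D A Z) {v : V} (hv : v ∈ Z) :
    Candidates D (A \ {v}) (Z \ {v} ∪ {u ∈ A \ {v} | u ∈ D.N ∧ (u, v) ∈ D.E}) where
  winning_subset u hu := by
    have huv : u ≠ v := fun e => (h.winning_subset hu).2 (e ▸ hv)
    refine ⟨⟨(h.winning_subset hu).1, huv⟩, ?_⟩
    rintro (hZ | ⟨-, hN, he⟩)
    · exact (h.winning_subset hu).2 hZ.1
    · exact (h.winning_subset (D.closed u ⟨hu, hN⟩ v he)).2 hv
  pending_subset := Set.union_subset (Set.sdiff_subset_sdiff_left h.pending_subset) fun u hu => hu.1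
  closed u hu w he := by
    refine ⟨h.closed u ⟨⟨hu.1.1.1, fun hZ => hu.1.2 (.inl ⟨hZ, hu.1.1.2⟩)⟩, hu.2⟩ w he, ?_⟩
    rintro rfl
    exact hu.1.2 (.inr ⟨hu.1.1, hu.2, he⟩)

theorem Run.remove (h : Holds D A U c) {v : V} (hv : c.vs vCur = {v}) (hvT : v ∉ D.T) :
    Run D.toEnv removeProg c fun c' => Holds D (A \ {v}) (U \ {v}) c' ∧
      c'.vs vPending = c.vs vPending ∪ {u ∈ A \ {v} | u ∈ D.N ∧ (u, v) ∈ D.E} ∧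
      c'.num rFlag = c.num rFlag ∧ c'.ops = c.ops + (6 + D.size) := by
  obtain ⟨es, rs, hmem, hrec⟩ := h
  refine .seq <| (Run.label hmem hv).mono fun c₁ ⟨hvs, hnum, hlabel, hops⟩ => .seq <|
    .primrec _ ((hnum _ (by simp)).trans hmem.edges) hlabel fun m₁ hedges hm₁ => .seq <|
    .primrec _ (((hm₁ _ (by decide) (by decide)).trans (hnum _ (by simp))).trans hmem.read)
      ((hm₁ _ (by decide) (by decide)).trans hlabel) fun m₂ hread hm₂ => .seq <| .diff <|
    .seq <| .diff <| .seq <| .pre <| .seq <| .inter <| .seq <| .inter <| .union ?_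
  have hm : ∀ i < rLabel, i ≠ rEdges → i ≠ rRead → m₂ i = c.num i := fun i hi h₁ h₂ =>
    (hm₂ i (hi.trans (by decide)) h₂).trans <|
      (hm₁ i (hi.trans (by decide)) h₁).trans (hnum i hi)
  simp only [Conf.setV, Conf.tick, Function.update_apply, hvs, hv, hops]
  refine ⟨⟨_, _, ⟨(hm _ (by simp) (by simp) (by simp)).trans hmem.param,
    (hm _ (by simp) (by simp) (by simp)).trans hmem.bits,
    (hm₂ _ (by decide) (by decide)).trans hedges, hread, congrArg (· \ {v}) hmem.cand,
    congrArg (· \ {v}) hmem.unread, hmem.random, hmem.target, fun i hi => ?_⟩, hrec.remove hvT⟩,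
    ?_, hm _ (by simp) (by simp) (by simp), by omega⟩
  · simpa +arith [Function.update_apply] using hmem.digits i hi
  · ext u
    simp [hmem.cand, hmem.random, and_assoc, and_comm]

/-- The number of symbolic operations for the removal of a candidate. -/
def removeCost (D : Task V) : ℕ := 9 + D.size

theorem Run.removePending [Finite V] (h : Holds D A U c) (hcand : Candidates D A (c.vs vPending)) :
    Run D.toEnv removePending c fun c' => ∃ A' ⊆ A \ c.vs vPending, Holds D A' (U ∩ A') c' ∧
      Candidates D A' ∅ ∧ c'.num rFlag = c.num rFlag ∧
      c'.ops + removeCost D * A'.ncard ≤ c.ops + 1 + removeCost D * A.ncard := by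
  refine .whileNonempty (fun c' => ∃ A' ⊆ A, c.vs vPending ∩ A' ⊆ c'.vs vPending ∧
    Holds D A' (U ∩ A') c' ∧ Candidates D A' (c'.vs vPending) ∧ c'.num rFlag = c.num rFlag ∧
    c'.ops + removeCost D * A'.ncard ≤ c.ops + 1 + removeCost D * A.ncard)
    (fun c => (c.vs vCand).ncard) ?_ ?_ ?_
  · rw [← Set.inter_eq_left.2 h.unread_subset] at h
    exact ⟨A, subset_rfl, Set.inter_subset_left, h.imp fun _ _ h => (h.setN _).tick 1, hcand, rfl,
      le_rfl⟩
  · rintro c₁ v ⟨A', hA', hpending, h', hcand', hflag, hops⟩ hv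
    have hvT : v ∉ D.T := fun hT => (hcand'.winning_subset (D.target_subset hT)).2 hv
    have hcard := Set.ncard_sdiff_singleton_add_one (hcand'.pending_subset hv)
    refine (Run.remove (h'.imp fun _ _ h => ((h.setV _).setV _).tick 2) (by simp) hvT).mono
      fun c₂ ⟨h₂, hpending₂, hflag₂, hops₂⟩ => ⟨⟨A' \ {v}, Set.sdiff_subset.trans hA', ?_, ?_, ?_,
        by simpa using hflag₂.trans hflag, ?_⟩, ?_⟩
    · simp only [Conf.tick, Conf.setN, Conf.setV, Function.update_apply] at hpending₂ ⊢
      grind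
    · rw [← Set.inter_sdiff_assoc]
      exact h₂.imp fun _ _ h => (h.setN _).tick 1
    · simpa [hpending₂] using hcand'.remove hv
    · rw [← hcard, mul_add] at hops
      simp only [Conf.ops_tick, Conf.ops_setN, Conf.ops_setV, removeCost] at hops₂ hops ⊢
      omega
    · simp [h₂.cand, h'.cand, ← hcard]
  · rintro c₁ ⟨A', hA', hpending, h', hcand', hflag, hops⟩ hempty
    rw [hempty] at hpending hcand'
    exact ⟨A', fun v hv => ⟨hA' hv, fun hZ => hpending ⟨hZ, hv⟩⟩, h', hcand', hflag, hops⟩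

end Removal

section Prune

/-- Store in `rFlag` the successor of the label of a trapped candidate, or `0` if there is none. -/
noncomputable def findProg : Prog := primrecProg primrec_findTrapped rFlag rEdges rRead

/-- Remove the candidate whose label is the predecessor of `rFlag`. -/
noncomputable def removeLabelled : Prog :=
  .set rLabel (.sub (cell rFlag) (.const 1)) ;; vertexProg ;; removePending

/-- Remove the candidates from which no path of recorded edges leads to `vUnread`. -/
noncomputable def pruneProg : Prog :=
  findProg ;; .loop (cell rFlag) (removeLabelled ;; findProg)

/-- An upper bound on the number of symbolic operations for the removal of a candidate, including
the search for it. -/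
def pruneCost (D : Task V) : ℕ := removeCost D + (D.size + 2)

variable {V : Type*} {D : Task V} {A U : Set V} {es : List (ℕ × ℕ)} {rs : List ℕ} {c : Conf V}

theorem Records.notMem_winning_of_trapped (h : Records D A U es rs) (hW : D.W ⊆ A) {v : V}
    (hv : D.lab v ∈ trapped es rs) : v ∉ D.W := by
  have hread : ∀ {u}, D.lab u ∈ trapped es rs → u ∈ A \ U := fun hu => by
    obtain ⟨u', hu', hlab⟩ := (h.mem_read _).1 (trapped_subset hu)
    exact D.lab_injective hlab ▸ hu'
  intro hvW
  obtain ⟨k, hk⟩ := D.leads v hvW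
  induction hk with
  | base _ hT => exact (hread hv).2 (h.target_subset hT)
  | step _ he hk ih =>
    exact ih (mem_trapped_of_edge hv (h.complete _ (hread hv) _ (hW hk.mem) he)) hk.mem

theorem Records.leads_unread (h : Records D A U es rs) (hnil : trapped es rs = []) {v : V}
    (hv : v ∈ A) : Leads D.E A U v := by
  by_cases hvU : v ∈ U
  · exact .base hv hvU
  refine induction_of_notMem_trapped (C := fun x => ∀ v ∈ A, D.lab v = x → Leads D.E A U v)
    ?_ ((h.mem_read _).2 ⟨v, ⟨hv, hvU⟩, rfl⟩) (hnil ▸ List.not_mem_nil) v hv rfl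
  rintro _ - y he ih v hv rfl
  obtain ⟨w, hw, hvw, rfl⟩ := h.sound v hv y he
  by_cases hwU : w ∈ U
  · exact .step hv hvw (.base hw hwU)
  · exact .step hv hvw (ih ((h.mem_read _).2 ⟨w, ⟨hw, hwU⟩, rfl⟩) w hw rfl)

theorem Run.findTrapped (h : Holds D A U c) (hW : D.W ⊆ A) :
    Run D.toEnv findProg c fun c' => Holds D A U c' ∧
      (c'.num rFlag = 0 → ∀ v ∈ A, Leads D.E A U v) ∧
      (c'.num rFlag ≠ 0 → ∃ v ∈ A \ D.W, D.lab v = c'.num rFlag - 1) ∧ c'.ops = c.ops := by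
  obtain ⟨es, rs, hmem, hrec⟩ := h
  refine .primrec _ hmem.edges hmem.read fun m hflag hm => ⟨⟨es, rs, hmem.congr
    (fun i hi => hm i (hi.trans_lt (by decide)) (hi.trans_lt (by decide)).ne) fun _ _ => rfl,
    hrec⟩, fun h0 v hv => ?_, fun h0 => ?_, rfl⟩
  · refine hrec.leads_unread (trapped_eq_nil_of_findTrapped ?_) hv
    exact Encodable.encode_injective (hflag.symm.trans h0)
  · cases hfind : Symbolic.findTrapped es rs with
    | none => exact absurd (hflag.trans (congrArg _ hfind)) h0
    | some x =>
      have htrapped := mem_trapped_of_findTrapped hfind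
      obtain ⟨v, hv, rfl⟩ := (hrec.mem_read x).1 (trapped_subset htrapped)
      exact ⟨v, ⟨hv.1, hrec.notMem_winning_of_trapped hW htrapped⟩,
        (congrArg (· - 1) (hflag.trans (congrArg _ hfind))).symm⟩

theorem Candidates.singleton (h : Candidates D A ∅) {v : V} (hv : v ∈ A \ D.W) :
    Candidates D A {v} where
  winning_subset _ hu := ⟨(h.winning_subset hu).1, fun e => hv.2 (e ▸ hu)⟩
  pending_subset := Set.singleton_subset_iff.2 hv.1
  closed _ hu := h.closed _ ⟨⟨hu.1.1, id⟩, hu.2⟩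

theorem Run.removeLabelled [Finite V] (h : Holds D A U c) (hcand : Candidates D A ∅) {v : V}
    (hv : v ∈ A \ D.W) (hlab : D.lab v = c.num rFlag - 1) :
    Run D.toEnv removeLabelled c fun c' => ∃ A' ⊆ A \ {v}, Holds D A' (U ∩ A') c' ∧
      Candidates D A' ∅ ∧
      c'.ops + removeCost D * A'.ncard ≤ c.ops + (D.size + 2) + removeCost D * A.ncard := by
  obtain ⟨es, rs, hmem, hrec⟩ := h
  have hlabel : (cell rFlag |>.sub (.const 1)).eval c.num = D.lab v := hlab.symm
  refine .seq <| .set <| .seq <| (Run.vertex (hmem.setN _) ?_).mono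
    fun c₁ ⟨hnum, hvs, hpending, hops⟩ => ?_
  · simpa only [hlabel, Conf.num_setN, Function.update_self] using D.lab_lt v
  have hsingle : c₁.vs vPending = {v} := by
    rw [hpending]
    ext w
    simp only [hlabel, Conf.num_setN, Function.update_self, Set.mem_ofPred_eq,
      D.lab_injective.eq_iff, Set.mem_singleton_iff]
    exact and_iff_right_of_imp fun hwv => hwv ▸ hv.1
  have h₁ : Holds D A U c₁ := ⟨es, rs, (hmem.setN (i := rLabel) _).congr
    (fun i hi => hnum i (hi.trans_lt (by simp))) (fun i hi => hvs i (by grind)), hrec⟩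
  refine (Run.removePending h₁ (hsingle ▸ hcand.singleton hv)).mono
    fun c₂ ⟨A', hA', h₂, hcand₂, _, hops₂⟩ => ⟨A', hsingle ▸ hA', h₂, hcand₂, ?_⟩
  simp only [hops, Conf.ops_setN] at hops₂
  omega

theorem Run.prune [Finite V] (h : Holds D A U c) (hcand : Candidates D A ∅) :
    Run D.toEnv pruneProg c fun c' => ∃ A' ⊆ A, Holds D A' (U ∩ A') c' ∧ Candidates D A' ∅ ∧
      (∀ v ∈ A', Leads D.E A' (U ∩ A') v) ∧
      c'.ops + pruneCost D * A'.ncard ≤ c.ops + pruneCost D * A.ncard := by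
  have hU := Set.inter_eq_left.2 h.unread_subset
  refine .seq <| (Run.findTrapped h fun v hv => (hcand.winning_subset hv).1).mono
    fun c₀ ⟨h₀, hleads₀, hfound₀, hops₀⟩ => .loop (fun c' => ∃ A' ⊆ A, Holds D A' (U ∩ A') c' ∧
      Candidates D A' ∅ ∧ (c'.num rFlag = 0 → ∀ v ∈ A', Leads D.E A' (U ∩ A') v) ∧
      (c'.num rFlag ≠ 0 → ∃ v ∈ A' \ D.W, D.lab v = c'.num rFlag - 1) ∧
      c'.ops + pruneCost D * A'.ncard ≤ c.ops + pruneCost D * A.ncard)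
    (fun c => (c.vs vCand).ncard) ?_ ?_ ?_
  · rintro c₁ ⟨A₁, hA₁, h₁, hcand₁, -, hfound₁, hops₁⟩ hflag
    obtain ⟨v, hv, hlab⟩ := hfound₁ hflag
    have hinter {A' : Set V} (hA' : A' ⊆ A₁ \ {v}) : U ∩ A₁ ∩ A' = U ∩ A' := by
      rw [Set.inter_assoc, Set.inter_eq_right.2 (hA'.trans Set.sdiff_subset)]
    refine .seq <| (Run.removeLabelled h₁ hcand₁ hv hlab).mono
      fun c₂ ⟨A₂, hA₂, h₂, hcand₂, hops₂⟩ =>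
        (Run.findTrapped h₂ fun v hv => (hcand₂.winning_subset hv).1).mono
        fun c₃ ⟨h₃, hleads₃, hfound₃, hops₃⟩ => ?_
    have hcard : A₂.ncard < A₁.ncard :=
      Set.ncard_lt_ncard ⟨hA₂.trans Set.sdiff_subset, fun hA => (hA₂ (hA hv.1)).2 rfl⟩
    rw [hinter hA₂] at h₃ hleads₃
    refine ⟨⟨A₂, hA₂.trans (Set.sdiff_subset.trans hA₁), h₃, hcand₂, hleads₃, hfound₃, ?_⟩,
      by rwa [h₃.cand, h₁.cand]⟩
    have hmul := Nat.mul_le_mul_left (D.size + 2) hcard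
    simp only [pruneCost, add_mul, Nat.mul_succ] at hops₁ hmul ⊢
    omega
  · rintro c₁ ⟨A₁, hA₁, h₁, hcand₁, hleads₁, -, hops₁⟩ hflag
    exact ⟨A₁, hA₁, h₁, hcand₁, hleads₁ hflag, hops₁⟩
  · exact ⟨A, subset_rfl, hU.symm ▸ h₀, hcand, hU.symm ▸ hleads₀, hfound₀,
      Nat.add_le_add_right hops₀.le _⟩

end Prune

section Reach

/-- Add to `vQueue` the candidates with a successor in `vQueue`, and set `rGrow` to `0` if there is
nothing to add, and to `1` otherwise. -/
def growProg : Prog :=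
  .pre vCur vQueue ;;
  .inter vCur vCur vCand ;;
  .subset rGrow vCur vQueue ;;
  .set rGrow (.sub (.const 1) (cell rGrow)) ;;
  .union vQueue vQueue vCur

/-- Store in `vQueue` the candidates from which a path of candidates leads to the target. -/
def reachTarget : Prog :=
  .union vQueue vTarget vTarget ;; .set rGrow (.const 1) ;; .loop (cell rGrow) growProg

/-- Remove the candidates from which no path of candidates leads to the target, and set `rFlag` to
their number. -/
noncomputable def reachProg : Prog :=
  reachTarget ;;
  .diff vPending vCand vQueue ;;
  .card rFlag vPending ;;
  removePending

variable {V : Type*} {D : Task V} {A U : Set V} {c : Conf V}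

theorem Candidates.leads_target (h : Candidates D A ∅) {v : V} (hv : v ∈ D.W) :
    Leads D.E A D.T v := by
  obtain ⟨k, hk⟩ := D.leads v hv
  induction hk with
  | base hW hT => exact .base (h.winning_subset hW).1 hT
  | step hW he hk ih => exact .step (h.winning_subset hW).1 he (ih hk.mem)

theorem Candidates.unreachable (h : Candidates D A ∅) :
    Candidates D A (A \ {v | Leads D.E A D.T v}) where
  winning_subset _ hv := ⟨(h.winning_subset hv).1, fun hZ => hZ.2 (h.leads_target hv)⟩
  pending_subset := Set.sdiff_subset
  closed _ hu := h.closed _ ⟨⟨hu.1.1, id⟩, hu.2⟩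

theorem Candidates.eq_winning (h : Candidates D A ∅) (hA : ∀ v ∈ A, Leads D.E A D.T v) :
    A = D.W :=
  (D.maximal A (fun v hv => h.closed v ⟨⟨hv.1, id⟩, hv.2⟩) hA).antisymm
    fun _ hv => (h.winning_subset hv).1

open Classical in
theorem Run.grow (h : Holds D A U c) :
    Run D.toEnv growProg c fun c' => Holds D A U c' ∧
      c'.vs vQueue = c.vs vQueue ∪ {v ∈ A | ∃ w ∈ c.vs vQueue, (v, w) ∈ D.E} ∧
      c'.num rGrow = (if {v ∈ A | ∃ w ∈ c.vs vQueue, (v, w) ∈ D.E} ⊆ c.vs vQueue then 0 else 1) ∧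
      c'.ops = c.ops + 4 := by
  have hset : {v | ∃ w ∈ c.vs vQueue, (v, w) ∈ D.E} ∩ A =
      {v ∈ A | ∃ w ∈ c.vs vQueue, (v, w) ∈ D.E} := Set.inter_comm ..
  refine .seq <| .pre <| .seq <| .inter <| .seq <| .subset <| .seq <| .set <| .union
    ⟨h.imp fun _ _ h => ((((((((h.setV _).tick _).setV _).tick _).setN _).tick _).setN
      (i := rGrow) _).setV _).tick _, ?_, ?_, rfl⟩
  · simp [h.cand, hset]
  · by_cases hsub : {v ∈ A | ∃ w ∈ c.vs vQueue, (v, w) ∈ D.E} ⊆ c.vs vQueue <;>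
      simp [Expr.eval, h.cand, hset, hsub]

theorem Run.reachTarget [Finite V] (h : Holds D A U c) :
    Run D.toEnv reachTarget c fun c' => Holds D A U c' ∧
      c'.vs vQueue = {v | Leads D.E A D.T v} ∧ c'.ops ≤ c.ops + (4 * A.ncard + 5) := by
  refine .seq <| .union <| .seq <| .set <| .loop (fun c' => Holds D A U c' ∧ D.T ⊆ c'.vs vQueue ∧
    c'.vs vQueue ⊆ {v | Leads D.E A D.T v} ∧
    (c'.num rGrow = 0 → {v ∈ A | ∃ w ∈ c'.vs vQueue, (v, w) ∈ D.E} ⊆ c'.vs vQueue) ∧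
    c'.ops + 4 * ((A \ c'.vs vQueue).ncard + c'.num rGrow) ≤ c.ops + (4 * A.ncard + 5))
    (fun c => (A \ c.vs vQueue).ncard + c.num rGrow) ?_ ?_ ?_
  · rintro c₁ ⟨h₁, hT, hleads, -, hops⟩ (hb : c₁.num rGrow ≠ 0)
    refine (Run.grow h₁).mono fun c₂ ⟨h₂, hqueue, hgrow, hops₂⟩ => ?_
    have hlt : (A \ c₂.vs vQueue).ncard + c₂.num rGrow < (A \ c₁.vs vQueue).ncard +
        c₁.num rGrow := by
      have hmono : A \ c₂.vs vQueue ⊆ A \ c₁.vs vQueue :=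
        Set.sdiff_subset_sdiff_right (hqueue ▸ Set.subset_union_left)
      rw [hgrow]
      split_ifs with hsub
      · have := Set.ncard_le_ncard hmono
        omega
      · obtain ⟨v, hv, hvq⟩ := Set.not_subset.1 hsub
        have := Set.ncard_lt_ncard (hmono.ssubset_of_mem_notMem ⟨hv.1, hvq⟩
          fun h => h.2 (hqueue ▸ .inr hv))
        omega
    refine ⟨⟨h₂, ?_, ?_, fun h0 => ?_, by rw [hops₂]; omega⟩, hlt⟩
    · exact hqueue ▸ hT.trans Set.subset_union_left
    · rw [hqueue]
      exact Set.union_subset hleads fun v ⟨hv, w, hw, he⟩ => Leads.step hv he (hleads hw)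
    · have hsub : {v ∈ A | ∃ w ∈ c₁.vs vQueue, (v, w) ∈ D.E} ⊆ c₁.vs vQueue := by
        by_contra hsub
        simp [hgrow, hsub] at h0
      rw [hqueue, Set.union_eq_left.2 hsub]
      exact hsub
  · rintro c₁ ⟨h₁, hT, hleads, hclosed, hops⟩ hb
    refine ⟨h₁, hleads.antisymm fun v ⟨k, hk⟩ => ?_, (Nat.le_add_right ..).trans hops⟩
    induction hk with
    | base _ hT' => exact hT hT'
    | step hA he hk ih => exact hclosed hb ⟨hA, _, ih ⟨_, hk⟩, he⟩
  · have hTA : D.T ⊆ A :=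
      let ⟨_, _, _, hrec⟩ := h
      hrec.target_subset.trans hrec.unread_subset
    have htarget : c.vs vTarget = D.T :=
      let ⟨_, _, hmem, _⟩ := h
      hmem.target
    have hcard := Set.ncard_sdiff_add_ncard_of_subset hTA
    refine ⟨h.imp fun _ _ h => ((h.setV _).tick _).setN (i := rGrow) _, ?_⟩
    simp only [Expr.eval, Conf.setN, Conf.setV, Conf.tick, Function.update_apply, htarget,
      Set.union_self, if_true]
    exact ⟨subset_rfl, fun v hv => Leads.base (hTA hv) hv, nofun, by omega⟩

theorem Run.reach [Finite V] (h : Holds D A U c) (hcand : Candidates D A ∅) :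
    Run D.toEnv reachProg c fun c' => ∃ A' ⊆ A, Holds D A' (U ∩ A') c' ∧ Candidates D A' ∅ ∧
      (∀ v ∈ A', Leads D.E A D.T v) ∧ (c'.num rFlag = 0 → A' = D.W) ∧
      (c'.num rFlag ≠ 0 → ∃ v ∈ A, ¬ Leads D.E A D.T v) ∧
      c'.ops + removeCost D * A'.ncard ≤ c.ops + (4 * A.ncard + 8) + removeCost D * A.ncard := by
  refine .seq <| (Run.reachTarget h).mono fun c₁ ⟨h₁, hreach, hops₁⟩ => .seq <| .diff <| .seq <|
    .card <| (Run.removePending (A := A) (U := U) ?_ ?_).mono ?_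
  · exact h₁.imp fun _ _ h => (((h.setV _).tick _).setN (i := rFlag) _).tick _
  · simpa [h₁.cand, hreach] using hcand.unreachable
  · rintro c₂ ⟨A', hA', h₂, hcand₂, hflag, hops⟩
    simp only [Conf.vs_tick, Conf.vs_setN, Conf.vs_setV, Function.update_self, h₁.cand, hreach,
      Conf.num_tick, Conf.num_setN, Conf.ops_tick, Conf.ops_setN, Conf.ops_setV] at hA' hflag hops
    refine ⟨A', hA'.trans Set.sdiff_subset, h₂, hcand₂, fun v hv => ?_, fun h0 => ?_, fun h0 => ?_,
      hops.trans (Nat.add_le_add_right (Nat.add_le_add_right hops₁ 3) _)⟩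
    · exact by_contra fun hlead => (hA' hv).2 ⟨(hA' hv).1, hlead⟩
    · have hempty := (Set.ncard_eq_zero (Set.toFinite _)).1 (hflag.symm.trans h0)
      have hW := hcand.eq_winning (Set.sdiff_eq_empty.1 hempty)
      exact ((hA'.trans Set.sdiff_subset).trans hW.subset).antisymm fun v hv =>
        (hcand₂.winning_subset hv).1
    · obtain ⟨v, hv⟩ := Set.nonempty_of_ncard_ne_zero (hflag ▸ h0)
      exact ⟨v, hv⟩

end Reach

section Scan

/-- Record the edge from the vertex with the label in `rTail` to the vertex in `vNbr`. -/
noncomputable def recordProg : Prog :=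
  labelProg vNbr ;;
  primrecProg (Primrec₂.pair (α := ℕ) (β := ℕ)) rLabel rTail rLabel ;;
  primrecProg (Primrec.list_cons (α := ℕ × ℕ)) rEdges rLabel rEdges

/-- Record the edges from the vertex with the label in `rTail` to the vertices in `vNbrs`. -/
noncomputable def recordEdges : Prog := whileNonempty vNbrs vNbr recordProg

/-- Record the edges from the vertex in `vCur` to the vertices in `vNbrs`. -/
noncomputable def readProg : Prog :=
  labelProg vCur ;;
  .set rTail (cell rLabel) ;;
  recordEdges ;;
  primrecProg (Primrec.list_cons (α := ℕ)) rRead rTail rRead ;;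
  .diff vUnread vUnread vCur

/-- Store the successors of the vertex in `vCur` that are candidates in `vNbrs`, and their number in
`rTail`. -/
def nbrsProg : Prog :=
  .post vNbrs vCur ;; .inter vNbrs vNbrs vCand ;; .card rTail vNbrs

/-- Record the edges from the vertex in `vCur` to candidates, unless their number exceeds the
trade-off parameter. -/
noncomputable def scanVertex : Prog :=
  nbrsProg ;; .ite (.sub (.add (cell rParam) (.const 1)) (cell rTail)) readProg .skip

/-- Run `scanVertex` for all unread candidates outside the target. -/
noncomputable def scanProg : Prog :=
  .diff vQueue vUnread vTarget ;; whileNonempty vQueue vCur scanVertex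

/-- An upper bound on the number of symbolic operations for recording the edges of a vertex. -/
def readCost {V : Type*} (D : Task V) : ℕ := D.size + 2 + (D.size + 3) * D.p

variable {V : Type*} {D : Task V} {A U : Set V} {es : List (ℕ × ℕ)} {rs : List ℕ} {c : Conf V}

theorem Run.record (h : Memory D A U es rs c) {w : V} (hw : c.vs vNbr = {w}) :
    Run D.toEnv recordProg c fun c' => Memory D A U ((c.num rTail, D.lab w) :: es) rs c' ∧
      c'.vs = c.vs ∧ c'.num rTail = c.num rTail ∧ c'.ops = c.ops + D.size := by
  refine .seq <| (Run.label h hw).mono fun c₁ ⟨hvs, hnum, hlabel, hops⟩ => .seq <|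
    .primrec (a := c.num rTail) _ (hnum _ (by simp)) hlabel fun m₁ hedge hm₁ =>
    .primrec _ hedge
      (((hm₁ _ (by decide) (by decide)).trans (hnum _ (by simp))).trans h.edges)
      fun m₂ hedges hm₂ => ?_
  have hm : ∀ i < rLabel, i ≠ rEdges → m₂ i = c.num i := fun i hi hne =>
    (hm₂ i (hi.trans (by decide)) hne).trans <|
      (hm₁ i (hi.trans (by decide)) hi.ne).trans (hnum i hi)
  exact ⟨⟨(hm _ (by simp) (by simp)).trans h.param, (hm _ (by simp) (by simp)).trans h.bits,
    hedges, (hm _ (by simp) (by simp)).trans h.read, hvs ▸ h.cand, hvs ▸ h.unread,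
    hvs ▸ h.random, hvs ▸ h.target, hvs ▸ h.digits⟩, hvs, hm _ (by simp) (by simp), hops⟩

theorem Run.recordEdges [Finite V] (h : Memory D A U es rs c) :
    Run D.toEnv recordEdges c fun c' => ∃ es', Memory D A U es' rs c' ∧
      (∀ e, e ∈ es' ↔ e ∈ es ∨ ∃ w ∈ c.vs vNbrs, e = (c.num rTail, D.lab w)) ∧
      c'.vs vQueue = c.vs vQueue ∧ c'.vs vCur = c.vs vCur ∧ c'.num rTail = c.num rTail ∧
      c'.ops ≤ c.ops + (1 + (D.size + 3) * (c.vs vNbrs).ncard) := by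
  refine .whileNonempty (fun c' => ∃ es', Memory D A U es' rs c' ∧
    (∀ e, e ∈ es' ↔ e ∈ es ∨ ∃ w ∈ c.vs vNbrs \ c'.vs vNbrs, e = (c.num rTail, D.lab w)) ∧
    c'.vs vNbrs ⊆ c.vs vNbrs ∧
    c'.vs vQueue = c.vs vQueue ∧ c'.vs vCur = c.vs vCur ∧ c'.num rTail = c.num rTail ∧
    c'.ops + (D.size + 3) * (c'.vs vNbrs).ncard ≤
      c.ops + (1 + (D.size + 3) * (c.vs vNbrs).ncard)) (fun c => (c.vs vNbrs).ncard) ?_ ?_ ?_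
  · exact ⟨es, (h.setN _).tick _, by simp, by simp, rfl, rfl, by simp, by simp +arith⟩
  · rintro c₁ w ⟨es₁, h₁, hes, hsub, hqueue, hcur, htail, hops⟩ hw
    have hcard := Set.ncard_sdiff_singleton_add_one hw
    refine (Run.record (((h₁.setV _).setV _).tick 2) (w := w) (by simp)).mono
      fun c₂ ⟨h₂, hvs, htail₂, hops₂⟩ => ⟨⟨_, (h₂.setN _).tick _, ?_⟩, ?_⟩
    · rw [← hcard, mul_add] at hops
      simp only [Conf.tick, Conf.setN, Conf.setV, hvs, htail₂, hops₂, htail,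
        Function.update_apply, List.mem_cons, hes]
      refine ⟨fun e => ?_, ?_, hqueue, hcur, by simp, ?_⟩
      · grind
      · grind
      · grind
    · simp [hvs, ← hcard]
  · rintro c₁ ⟨es₁, h₁, hes, -, hqueue, hcur, htail, hops⟩ hempty
    simp only [hempty, Set.sdiff_empty] at hes
    exact ⟨es₁, h₁, hes, hqueue, hcur, htail, (Nat.le_add_right ..).trans hops⟩

theorem Run.read [Finite V] (h : Holds D A U c) {v : V} (hv : v ∈ U \ D.T)
    (hcur : c.vs vCur = {v}) (hnbrs : c.vs vNbrs = {w ∈ A | (v, w) ∈ D.E}) :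
    Run D.toEnv readProg c fun c' => Holds D A (U \ {v}) c' ∧ c'.vs vQueue = c.vs vQueue ∧
      c'.ops ≤ c.ops + (D.size + 2 + (D.size + 3) * (c.vs vNbrs).ncard) := by
  obtain ⟨es, rs, hmem, hrec⟩ := h
  refine .seq <| (Run.label hmem hcur).mono fun c₁ ⟨hvs₁, hnum, hlabel, hops₁⟩ => .seq <| .set ?_
  have h₁ : Memory D A U es rs c₁ :=
    hmem.congr (fun i hi => hnum i (hi.trans_lt (by decide))) fun i _ => by rw [hvs₁]
  refine .seq <| (Run.recordEdges (h₁.setN (i := rTail) _)).mono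
    fun c₂ ⟨es₂, h₂, hes, hqueue, hcur₂, htail, hops₂⟩ => .seq <|
    .primrec (a := D.lab v) _ ?_ h₂.read fun m hread hm => .diff ?_
  · exact htail.trans (by simpa [Expr.eval] using hlabel)
  have hm' : ∀ i < rRead, m i = c₂.num i := fun i hi => hm i (hi.trans (by decide)) hi.ne
  have hcur' : c₂.vs vCur = {v} := hcur₂.trans ((congrFun hvs₁ _).trans hcur)
  simp only [Conf.setN, Expr.eval, hvs₁, hnbrs, hops₁, hlabel, Function.update_self]
    at hes hqueue hops₂
  refine ⟨⟨es₂, D.lab v :: rs, ⟨(hm' _ (by simp)).trans h₂.param, (hm' _ (by simp)).trans h₂.bits,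
    (hm' _ (by simp)).trans h₂.edges, hread, h₂.cand, ?_, h₂.random, h₂.target, fun i hi => ?_⟩,
    hrec.read hv (es' := es₂) fun e => ?_⟩, hqueue, ?_⟩
  · simp [h₂.unread, hcur']
  · simpa +arith [Conf.setV, Function.update_apply] using h₂.digits i hi
  · simp [hes, and_assoc]
  · rw [hnbrs]
    simp only [Conf.ops_tick, Conf.ops_setV]
    omega

theorem Run.nbrs (h : Holds D A U c) {v : V} (hcur : c.vs vCur = {v}) :
    Run D.toEnv nbrsProg c fun c' => Holds D A U c' ∧ c'.vs vQueue = c.vs vQueue ∧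
      c'.vs vCur = {v} ∧ c'.vs vNbrs = {w ∈ A | (v, w) ∈ D.E} ∧
      c'.num rTail = {w ∈ A | (v, w) ∈ D.E}.ncard ∧ c'.ops = c.ops + 3 := by
  have hnbrs : {w | (v, w) ∈ D.E} ∩ A = {w ∈ A | (v, w) ∈ D.E} := Set.inter_comm ..
  refine .seq <| .post <| .seq <| .inter <| .card ⟨h.imp fun _ _ h =>
    (((((h.setV _).tick _).setV _).tick _).setN (i := rTail) _).tick _, ?_⟩
  simp [hcur, h.cand, hnbrs]

theorem Run.scanVertex [Finite V] (h : Holds D A U c) {v : V} (hv : v ∈ U \ D.T)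
    (hcur : c.vs vCur = {v}) :
    Run D.toEnv scanVertex c fun c' => ∃ U' ⊆ U, U \ {v} ⊆ U' ∧ Holds D A U' c' ∧
      (v ∈ U' → D.p < {w ∈ A | (v, w) ∈ D.E}.ncard) ∧ c'.vs vQueue = c.vs vQueue ∧
      c'.ops + readCost D * U'.ncard ≤ c.ops + 3 + readCost D * U.ncard := by
  refine .seq <| (Run.nbrs h hcur).mono fun c₁ ⟨h₁, hqueue, hcur₁, hnbrs, htail, hops⟩ => ?_
  have hparam : c₁.num rParam = D.p :=
    let ⟨_, _, hmem, _⟩ := h₁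
    hmem.param
  refine .ite (fun hb => ?_) fun hb => .skip ?_ <;> simp only [Expr.eval, hparam, htail] at hb
  · have hle : (D.size + 3) * (c₁.vs vNbrs).ncard ≤ (D.size + 3) * D.p :=
      Nat.mul_le_mul_left _ (hnbrs ▸ by omega)
    have hcard := Set.ncard_sdiff_singleton_add_one hv.1
    refine (Run.read h₁ hv hcur₁ hnbrs).mono fun c₂ ⟨h₂, hqueue₂, hops₂⟩ =>
      ⟨U \ {v}, Set.sdiff_subset, subset_rfl, h₂, fun h => (h.2 rfl).elim,
        hqueue₂.trans hqueue, (Nat.add_le_add_right hops₂ _).trans ?_⟩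
    rw [← hcard, mul_add, readCost]
    omega
  · exact ⟨U, subset_rfl, Set.sdiff_subset, h₁, fun _ => by omega, hqueue, by rw [hops]⟩

theorem Run.scan [Finite V] (h : Holds D A U c) :
    Run D.toEnv scanProg c fun c' => ∃ U', Holds D A U' c' ∧
      (∀ u ∈ U' \ D.T, D.p < {w ∈ A | (u, w) ∈ D.E}.ncard) ∧
      c'.ops + readCost D * U'.ncard ≤ c.ops + (6 * U.ncard + 2) + readCost D * U.ncard := by
  refine .seq <| .diff <| .whileNonempty (fun c' => ∃ U' ⊆ U, Holds D A U' c' ∧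
    c'.vs vQueue ⊆ U' \ D.T ∧
    (∀ u ∈ U' \ D.T, u ∉ c'.vs vQueue → D.p < {w ∈ A | (u, w) ∈ D.E}.ncard) ∧
    c'.ops + 6 * (c'.vs vQueue).ncard + readCost D * U'.ncard ≤
      c.ops + (6 * U.ncard + 2) + readCost D * U.ncard) (fun c => (c.vs vQueue).ncard) ?_ ?_ ?_
  · have hqueue : c.vs vUnread \ c.vs vTarget = U \ D.T :=
      let ⟨_, _, hmem, _⟩ := h
      hmem.unread ▸ hmem.target ▸ rfl
    have hcard := Set.ncard_le_ncard (Set.sdiff_subset (s := U) (t := D.T))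
    refine ⟨U, subset_rfl, h.imp fun _ _ h => (((h.setV _).tick _).setN _).tick _, ?_⟩
    simp only [Conf.tick, Conf.setN, Conf.setV, hqueue, Function.update_self]
    exact ⟨subset_rfl, fun _ h h' => (h' h).elim, by omega⟩
  · rintro c₁ v ⟨U₁, hU₁, h₁, hqueue, hscanned, hops⟩ hv
    have hcard := Set.ncard_sdiff_singleton_add_one hv
    refine (Run.scanVertex (h₁.imp fun _ _ h => ((h.setV _).setV _).tick 2) (hqueue hv)
      (by simp)).mono fun c₂ ⟨U₂, hU₂, hsub, h₂, hv₂, hqueue₂, hops₂⟩ =>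
      ⟨⟨U₂, hU₂.trans hU₁, h₂.imp fun _ _ h => (h.setN _).tick _, ?_, ?_, ?_⟩, ?_⟩
    all_goals simp only [Conf.tick, Conf.setN, Conf.setV, hqueue₂, Function.update_self] at hops₂ ⊢
    · exact fun u hu => ⟨hsub ⟨(hqueue hu.1).1, hu.2⟩, (hqueue hu.1).2⟩
    · rintro u ⟨hu, huT⟩ hu'
      by_cases huv : u = v
      · exact huv ▸ hv₂ (huv ▸ hu)
      · exact hscanned u ⟨hU₂ hu, huT⟩ fun h => hu' ⟨h, huv⟩
    · omega
    · omega
  · rintro c₁ ⟨U', -, h', -, hscanned, hops⟩ hempty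
    exact ⟨U', h', fun u hu => hscanned u hu (hempty ▸ id),
      (Nat.add_le_add_right (Nat.le_add_right ..) _).trans hops⟩

end Scan

section Rounds

/-- A round of the algorithm. Afterwards `rFlag` is the number of candidates from which no path of
candidates led to the target. -/
noncomputable def roundProg : Prog := scanProg ;; pruneProg ;; reachProg

/-- Run rounds until all candidates win. -/
noncomputable def solveProg : Prog := .set rFlag (.const 1) ;; .loop (cell rFlag) roundProg

variable {V : Type*} {D : Task V} {A U : Set V} {c : Conf V}

/- A vertex of `U` that does not lead to the target has more than `p` successors in `A`, and all of
them have been removed. -/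
theorem ncard_add_le_of_not_leads [Finite V] {E : Set (V × V)} {T A' A'' : Set V} {p : ℕ}
    (hA'' : A'' ⊆ A) (hU : ∀ u ∈ U \ T, p < {w ∈ A | (u, w) ∈ E}.ncard)
    (hleads : ∀ v ∈ A', Leads E A' (U ∩ A') v) (hreach : ∀ v ∈ A'', Leads E A' T v) {v : V}
    (hv : v ∈ A') (hvT : ¬ Leads E A' T v) : A''.ncard + (p + 1) ≤ A.ncard := by
  obtain ⟨u, hu, huT⟩ : ∃ u ∈ A' ∩ (U ∩ A'), ¬ Leads E A' T u := by
    by_contra! hall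
    exact hvT ((hleads v hv).trans hall)
  have hsub : {w ∈ A | (u, w) ∈ E} ⊆ A \ A'' := fun w hw =>
    ⟨hw.1, fun hwA => huT (.step hu.1 hw.2 (hreach w hwA))⟩
  have hdeg := hU u ⟨hu.2.1, fun hT => huT (.base hu.1 hT)⟩
  have hle := Set.ncard_le_ncard hsub
  have hcard := Set.ncard_sdiff_add_ncard_of_subset hA''
  omega

theorem Run.round [Finite V] (h : Holds D A U c) (hcand : Candidates D A ∅) :
    Run D.toEnv roundProg c fun c' => ∃ A' ⊆ A, ∃ U', Holds D A' U' c' ∧ Candidates D A' ∅ ∧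
      (c'.num rFlag = 0 → A' = D.W) ∧ (c'.num rFlag ≠ 0 → A'.ncard + (D.p + 1) ≤ A.ncard) ∧
      c'.ops + (pruneCost D * A'.ncard + readCost D * U'.ncard) ≤
        c.ops + 10 * (A.ncard + 1) + (pruneCost D * A.ncard + readCost D * U.ncard) := by
  refine .seq <| (Run.scan h).mono fun c₁ ⟨U₁, h₁, hread, hops₁⟩ => .seq <|
    (Run.prune h₁ hcand).mono fun c₂ ⟨A₂, hA₂, h₂, hcand₂, hleads, hops₂⟩ =>
    (Run.reach h₂ hcand₂).mono fun c₃ ⟨A₃, hA₃, h₃, hcand₃, hreach, hdone, hstuck, hops₃⟩ =>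
    ⟨A₃, hA₃.trans hA₂, _, h₃, hcand₃, hdone, fun h0 => ?_, ?_⟩
  · obtain ⟨v, hv, hvT⟩ := hstuck h0
    exact ncard_add_le_of_not_leads (hA₃.trans hA₂) hread hleads hreach hv hvT
  · have hUA := Set.ncard_le_ncard h.unread_subset
    have hA₂' := Set.ncard_le_ncard hA₂
    have hU₂ := Nat.mul_le_mul_left (readCost D) <| Set.ncard_le_ncard <|
      (Set.inter_subset_left (t := A₃)).trans (Set.inter_subset_left (s := U₁) (t := A₂))
    have hprune := Nat.mul_le_mul_left (D.size + 2) (Set.ncard_le_ncard hA₃)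
    simp only [pruneCost, add_mul] at hops₁ hops₂ hops₃ hprune ⊢
    omega

theorem Run.solve [Finite V] (h : Holds D A U c) (hcand : Candidates D A ∅) :
    Run D.toEnv solveProg c fun c' => c'.vs vCand = D.W ∧ c'.ops ≤ c.ops +
      10 * (A.ncard + 1) * (A.ncard / (D.p + 1) + 1) +
      (pruneCost D * A.ncard + readCost D * U.ncard) := by
  let rounds (c : Conf V) : ℕ :=
    (c.vs vCand).ncard / (D.p + 1) + if c.num rFlag = 0 then 0 else 1
  refine .seq <| .set <| .loop (fun c' => ∃ A' ⊆ A, ∃ U', Holds D A' U' c' ∧ Candidates D A' ∅ ∧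
    (c'.num rFlag = 0 → A' = D.W) ∧
    c'.ops + 10 * (A.ncard + 1) * rounds c' + (pruneCost D * A'.ncard + readCost D * U'.ncard) ≤
      c.ops + 10 * (A.ncard + 1) * (A.ncard / (D.p + 1) + 1) +
        (pruneCost D * A.ncard + readCost D * U.ncard)) rounds ?_ ?_ ?_
  · rintro c₁ ⟨A₁, hA₁, U₁, h₁, hcand₁, -, hops⟩ (hb : c₁.num rFlag ≠ 0)
    refine (Run.round h₁ hcand₁).mono fun c₂ ⟨A₂, hA₂, U₂, h₂, hcand₂, hdone, hstuck, hops₂⟩ =>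
      ?_
    have hrounds : rounds c₂ + 1 ≤ rounds c₁ := by
      simp only [rounds, h₁.cand, h₂.cand, if_neg hb]
      split_ifs with h0
      · exact Nat.add_le_add_right (Nat.div_le_div_right (Set.ncard_le_ncard hA₂)) 1
      · rw [← Nat.add_div_right _ D.p.succ_pos]
        exact Nat.add_le_add_right (Nat.div_le_div_right (hstuck h0)) 1
    refine ⟨⟨A₂, hA₂.trans hA₁, U₂, h₂, hcand₂, hdone, ?_⟩, hrounds⟩
    have hcard := Set.ncard_le_ncard hA₁
    have hmul := Nat.mul_le_mul_left (10 * (A.ncard + 1)) hrounds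
    rw [mul_add_one] at hmul
    omega
  · rintro c₁ ⟨A₁, -, U₁, h₁, -, hdone, hops⟩ hb
    exact ⟨h₁.cand.trans (hdone hb), by omega⟩
  · refine ⟨A, subset_rfl, U, h.imp fun _ _ h => h.setN _, hcand, ?_, ?_⟩
    · simp [Expr.eval]
    · simp [rounds, Expr.eval, h.cand]

end Rounds

section Setup

/-- Record the label in `rLabel` as the label of the vertex in `vCur`. -/
def writeLabel : Prog :=
  forDigits
    (.ite (.mod (.div (cell rLabel) (.pow (.const 2) (cell rDigit))) (.const 2))
      (.op (.vertexOp .union digitCell digitCell (.const vCur))) .skip)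

/-- Label the vertices in `vQueue` with consecutive numbers. -/
def enumerateProg : Prog :=
  whileNonempty vQueue vCur (writeLabel ;; .set rLabel (.add (cell rLabel) (.const 1)))

/-- Turn the input into the initial memory. The lists of recorded edges and of read vertices need
no initialization, since the empty list has the code `0`. -/
def setupProg : Prog :=
  .diff vRandom vRandom vTarget ;;
  .card rBits vCand ;;
  .set rBits (.add (.log (cell rBits)) (.const 1)) ;;
  .union vUnread vCand vCand ;;
  .union vQueue vCand vCand ;;
  enumerateProg

variable {V : Type*} {M : Env V} {c₀ c : Conf V} {lab : V → ℕ}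

theorem Run.writeLabel {v : V} (hbits : c.num rBits = M.size) (hv : c.vs vCur = {v}) :
    Run M writeLabel c fun c' => (∀ i < rDigit, c'.num i = c.num i) ∧
      (∀ i < digitBase, c'.vs i = c.vs i) ∧ (∀ i < M.size, c'.vs (digitBase + i) =
        c.vs (digitBase + i) ∪ {u | u = v ∧ c.num rLabel / 2 ^ i % 2 = 1}) ∧
      c'.ops ≤ c.ops + M.size := by
  refine .forDigits (fun k c' => (∀ i < rDigit, c'.num i = c.num i) ∧
    (∀ i < digitBase, c'.vs i = c.vs i) ∧ (∀ i, c'.vs (digitBase + i) =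
      c.vs (digitBase + i) ∪ {u | i < k ∧ u = v ∧ c.num rLabel / 2 ^ i % 2 = 1}) ∧
    c'.ops ≤ c.ops + k) (fun k c' hc' => (hc'.1 _ (by simp)).trans hbits) ?_ ?_ ?_
  · simp only [Conf.setN, Function.update_apply]
    grind
  · rintro k c' hk hdigit ⟨hnum, hvs, hdigits, hops⟩
    have hlabel : c'.num rLabel = c.num rLabel := hnum _ (by simp)
    have hcur : c'.vs vCur = {v} := (hvs _ (by simp)).trans hv
    refine .ite (fun hb => .vertexOp (by simp +arith [Expr.eval, Env.bound, hdigit]; omega) ?_)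
      (fun hb => .skip ?_)
    all_goals
      simp only [Expr.eval, hdigit, hlabel] at hb
      simp only [Expr.eval, SetOp.apply, hdigit, hcur, Conf.setN, Conf.setV, Conf.tick,
        Function.update_apply, hdigits]
      refine ⟨trivial, by grind, by grind, fun i => ?_, by omega⟩
      ext u
      grind
  · rintro c' ⟨hnum, hvs, hdigits, hops⟩
    refine ⟨hnum, hvs, fun i hi => ?_, hops⟩
    rw [hdigits]
    grind

/-- The state of the enumeration that was started in `c₀`: the vertices outside the queue have
labels, which are given by `lab`. -/
structure Labelled (M : Env V) (c₀ : Conf V) (lab : V → ℕ) (c : Conf V) : Prop where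
  num : ∀ i ≤ rRead, c.num i = c₀.num i
  vs : ∀ i ≤ vTarget, c.vs i = c₀.vs i
  injOn : Set.InjOn lab (c.vs vQueue)ᶜ
  lt : ∀ v ∉ c.vs vQueue, lab v < c.num rLabel
  count : c.num rLabel + (c.vs vQueue).ncard = Nat.card V
  digits : ∀ i < M.size,
    c.vs (digitBase + i) = {v | v ∉ c.vs vQueue ∧ lab v / 2 ^ i % 2 = 1}

open Classical in
theorem Labelled.update [Finite V] (h : Labelled M c₀ lab c) {v : V} (hv : v ∈ c.vs vQueue)
    {c' : Conf V} (hnum : ∀ i ≤ rRead, c'.num i = c.num i)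
    (hvs : ∀ i ≤ vTarget, c'.vs i = c.vs i) (hqueue : c'.vs vQueue = c.vs vQueue \ {v})
    (hlabel : c'.num rLabel = c.num rLabel + 1)
    (hdigits : ∀ i < M.size, c'.vs (digitBase + i) =
      c.vs (digitBase + i) ∪ {u | u = v ∧ c.num rLabel / 2 ^ i % 2 = 1}) :
    Labelled M c₀ (Function.update lab v (c.num rLabel)) c' where
  num i hi := (hnum i hi).trans (h.num i hi)
  vs i hi := (hvs i hi).trans (h.vs i hi)
  injOn u hu w hw he := by
    have hlt := h.lt
    have hinj : ∀ u ∉ c.vs vQueue, ∀ w ∉ c.vs vQueue, lab u = lab w → u = w :=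
      fun u hu w hw => h.injOn hu hw
    simp only [Set.mem_compl_iff, hqueue, Set.mem_sdiff, Set.mem_singleton_iff] at hu hw
    simp only [Function.update_apply] at he
    grind
  lt u hu := by
    have hlt := h.lt u
    simp only [hqueue, Set.mem_sdiff, Set.mem_singleton_iff] at hu
    simp only [Function.update_apply]
    grind
  count := by
    have hcard := Set.ncard_sdiff_singleton_add_one hv
    have hcount := h.count
    rw [hqueue, hlabel]
    omega
  digits i hi := by
    ext u
    rw [hdigits i hi, h.digits i hi, hqueue]
    simp only [Function.update_apply, Set.mem_union, Set.mem_ofPred_eq, Set.mem_sdiff,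
      Set.mem_singleton_iff]
    grind

theorem Run.enumerate [Finite V] (hbits : c.num rBits = M.size) (hlabel : c.num rLabel = 0)
    (hqueue : c.vs vQueue = Set.univ) (hdigits : ∀ i < M.size, c.vs (digitBase + i) = ∅) :
    Run M enumerateProg c fun c' => (∃ lab : V → ℕ, lab.Injective ∧ (∀ v, lab v < Nat.card V) ∧
        ∀ i < M.size, c'.vs (digitBase + i) = {v | lab v / 2 ^ i % 2 = 1}) ∧
      (∀ i ≤ rRead, c'.num i = c.num i) ∧ (∀ i ≤ vTarget, c'.vs i = c.vs i) ∧
      c'.ops ≤ c.ops + 1 + Nat.card V * (M.size + 3) := by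
  classical
  refine .whileNonempty (fun c' => (∃ lab, Labelled M c lab c') ∧
    c'.ops + (c'.vs vQueue).ncard * (M.size + 3) ≤ c.ops + 1 + Nat.card V * (M.size + 3))
    (fun c' => (c'.vs vQueue).ncard) ?_ ?_ ?_
  · refine ⟨⟨fun _ => 0, ?_⟩, by simp [hqueue]⟩
    constructor <;> simp only [Conf.setN, Conf.tick, Function.update_apply, hqueue]
    case digits => exact fun i hi => by simpa using hdigits i hi
    all_goals simp [hlabel] <;> grind
  · rintro c₁ v ⟨⟨lab, h⟩, hops⟩ hv
    refine .seq <| (Run.writeLabel (v := v) ?_ ?_).mono fun c₂ ⟨hnum, hvs, hdigits, hops₂⟩ =>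
      .set ?_
    · exact (h.num _ (by simp)).trans hbits
    · simp
    · have hqueue : c₂.vs vQueue = c₁.vs vQueue \ {v} := (hvs _ (by simp)).trans (by simp)
      have hcard := Set.ncard_sdiff_singleton_add_one hv
      rw [← hcard, add_mul] at hops
      simp only [Conf.setV, Conf.tick, Function.update_apply] at hnum hvs hops₂ hdigits
      simp only [Conf.setN, Conf.tick, Expr.eval, hqueue]
      refine ⟨⟨⟨_, h.update hv ?_ ?_ hqueue ?_ ?_⟩, by omega⟩, by omega⟩
      all_goals grind
  · rintro c₁ ⟨⟨lab, h⟩, hops⟩ hempty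
    refine ⟨⟨lab, ?_, fun v => ?_, fun i hi => ?_⟩, h.num, h.vs, le_of_add_le_left hops⟩
    · simpa [hempty, Set.injOn_univ] using h.injOn
    · simpa [← h.count, hempty] using h.lt v
    · simpa [hempty] using h.digits i hi

end Setup

section Algorithm

/-- The number of binary digits of the labels. -/
noncomputable def labelSize (V : Type*) : ℕ := Nat.log 2 (Nat.card V) + 1

/-- The environment of the executions for the MDP `P`. -/
noncomputable def inputEnv {V : Type*} (P : MDP V) (ρ : Picker V) : Env V :=
  ⟨ρ, labelSize V, P.E⟩

/-- The algorithm for almost-sure reachability. Its last operation leaves the result unchanged and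
ensures that the output cell stores a set, which a `Conf` does not express. -/
noncomputable def aswProg : Prog := setupProg ;; solveProg ;; .union vCand vCand vCand

theorem Candidates.univ {V : Type*} (D : Task V) : Candidates D Set.univ ∅ :=
  ⟨by simp, by simp, by simp⟩

theorem Records.univ {V : Type*} (D : Task V) : Records D Set.univ Set.univ [] [] :=
  ⟨subset_rfl, Set.subset_univ _, by simp, by simp, by simp⟩

theorem fits_init {V : Type*} (P : MDP V) (T : Set V) (ρ : Picker V) (p : ℕ) :
    (inputEnv P ρ).Fits (init P T p) := by
  have hv : ∀ i, (inputEnv P ρ).bound ≤ i → (init P T p).vset i = none := fun i hi => by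
    simp only [Env.bound, digitBase] at hi
    simp only [init, State.track]
    grind
  have he : ∀ i, i ≠ 0 → (init P T p).eset i = none := fun i hi => if_neg hi
  exact ⟨hv, he, rfl, max_le zero_le (stored_le hv he)⟩

variable {V : Type*} [Fintype V] [MeasurableSpace V] [DiscreteMeasurableSpace V]

/-- The task of computing the almost-sure winning set of `Reach T` in `P`. -/
noncomputable def aswTask (P : MDP V) (T : Set V) (ρ : Picker V) (p : ℕ) {lab : V → ℕ}
    (hinj : lab.Injective) (hlt : ∀ v, lab v < 2 ^ labelSize V) : Task V where
  toEnv := inputEnv P ρ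
  p := p
  T := T
  N := P.VR \ T
  W := P.ASW (P.Reach T)
  lab := lab
  target_subset := P.subset_asw_reach T
  closed _ hv _ he := P.asw_reach_random hv.1 hv.2.1 hv.2.2 he
  leads _ hv := P.asw_reach_leads hv
  maximal _ hR hL := P.subset_asw_of_closed (fun v hv hvR hvT => hR v ⟨hv, hvR, hvT⟩) hL
  lab_injective := hinj
  lab_lt := hlt

theorem Run.setup (P : MDP V) (T : Set V) (ρ : Picker V) (p : ℕ) :
    Run (inputEnv P ρ) setupProg (init P T p).conf fun c =>
      ∃ (lab : V → ℕ) (hinj : lab.Injective) (hlt : ∀ v, lab v < 2 ^ labelSize V),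
        Holds (aswTask P T ρ p hinj hlt) Set.univ Set.univ c ∧
        c.ops ≤ 5 + Nat.card V * (labelSize V + 3) := by
  refine .seq <| .diff <| .seq <| .card <| .seq <| .set <| .seq <| .union <| .seq <| .union <|
    (Run.enumerate ?_ ?_ ?_ ?_).mono fun c ⟨⟨lab, hinj, hlt, hdigits⟩, hnum, hvs, hops⟩ => ?_
  · simp [Expr.eval, State.conf, init, State.track, labelSize, inputEnv]
  · simp [Expr.eval, State.conf, init, State.track]
  · simp [Expr.eval, State.conf, init, State.track]
  · intro i _
    simp [Expr.eval, State.conf, init, State.track]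
    grind
  · have hlt' (v : V) : lab v < 2 ^ labelSize V :=
      (hlt v).trans (Nat.lt_pow_succ_log_self one_lt_two _)
    simp only [State.conf, init, State.track, Conf.setN, Conf.setV, Conf.tick,
      Function.update_apply] at hnum hvs hops
    refine ⟨lab, hinj, hlt', ⟨[], [], ?_, .univ _⟩, ?_⟩
    · constructor
      case digits => exact hdigits
      case param => exact hnum rParam (by simp)
      case bits => rw [hnum _ (by simp)]; simp [Expr.eval, labelSize, aswTask, inputEnv]
      case edges => exact hnum rEdges (by simp)
      case read => exact hnum rRead (by simp)
      case cand => rw [hvs _ (by simp)]; simp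
      case unread => rw [hvs _ (by simp)]; simp
      case random => rw [hvs _ (by simp)]; simp [aswTask]
      case target => rw [hvs _ (by simp)]; simp [aswTask]
    · exact hops.trans (by simp [inputEnv])

theorem total_cost_le {n L p q : ℕ} (hn : 1 ≤ n) (hL : 1 ≤ L) :
    6 + n * (L + 3) + 10 * (n + 1) * (q + 1) +
      ((9 + L + (L + 2)) * n + (L + 2 + (L + 3) * p) * n) ≤ 46 * L * (n * (p + 1 + q)) := by
  have hnL : n ≤ L * n := Nat.le_mul_of_pos_left n hL
  have hnpL : n * p ≤ L * (n * p) := Nat.le_mul_of_pos_left _ hL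
  have hnqL : n * q ≤ L * (n * q) := Nat.le_mul_of_pos_left _ hL
  have hq : q ≤ n * q := Nat.le_mul_of_pos_left _ hn
  linarith [Nat.zero_le (n * p), Nat.zero_le (n * q)]

theorem exists_computes_asw [Nonempty V] (P : MDP V) (T : Set V) (ρ : Picker V) (p : ℕ) :
    ∃ s, Computes ρ aswProg P T p (P.ASW (P.Reach T)) s ∧ s.peak ≤ (labelSize V + 10 : ℕ) ∧
      s.ops ≤ 46 * labelSize V * (Nat.card V * (p + 1 + Nat.card V / (p + 1))) := by
  obtain ⟨t, hsetup, ht, lab, hinj, hlt, hholds, hops⟩ :=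
    Run.setup P T ρ p _ (fits_init P T ρ p) rfl
  obtain ⟨u, hsolve, hu, hW, hops'⟩ := Run.solve hholds (.univ _) t ht rfl
  have hcand : (u.vset 0).getD ∅ = P.ASW (P.Reach T) := hW
  refine ⟨_, ⟨.seq hsetup (.seq hsolve (.op _ u)), ?_⟩, ?_, ?_⟩
  · simp [State.perform, State.effect, State.track, State.putV, State.val, Expr.eval, State.getV,
      SetOp.apply, hcand]
  · exact ((hu.putV (.const 0) _ (by simp [State.val, Expr.eval, Env.bound])).track
      (u.ops + 1)).peak.trans (Nat.cast_le.2 (by simp +arith [Env.bound, aswTask, inputEnv]))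
  · change u.ops + 1 ≤ _
    simp only [State.conf, pruneCost, removeCost, readCost, aswTask, inputEnv,
      Set.ncard_univ] at hops hops'
    have htotal := total_cost_le (p := p) (q := Nat.card V / (p + 1)) (Nat.card_pos (α := V))
      (L := labelSize V) (Nat.le_add_left ..)
    omega

theorem labelSize_le_log {V : Type*} (hn : 2 ≤ Nat.card V) :
    (labelSize V : ℝ) ≤ 3 * Real.log (Nat.card V) := by
  have hlog : Real.log 2 ≤ Real.log (Nat.card V) := Real.log_le_log two_pos (mod_cast hn)
  have hpow : Nat.log 2 (Nat.card V) * Real.log 2 ≤ Real.log (Nat.card V) := by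
    rw [← Real.log_pow]
    exact Real.log_le_log (by positivity) (mod_cast Nat.pow_log_le_self 2 (by omega))
  rw [labelSize, Nat.cast_add_one]
  nlinarith [Real.log_two_gt_d9, Nat.cast_nonneg (α := ℝ) (Nat.log 2 (Nat.card V))]

end Algorithm

end Symbolic

theorem mul_ceil_rpow_add_div_le {n ε : ℝ} (hn : 1 ≤ n) (hε : 0 ≤ ε) (hε' : ε ≤ 1 / 2) :
    n * (⌈n ^ ε⌉₊ + 1 + n / (⌈n ^ ε⌉₊ + 1)) ≤ 4 * n ^ (2 - ε) := by
  have hn0 : 0 < n := one_pos.trans_le hn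
  have hx : 1 ≤ n ^ ε := Real.one_le_rpow hn hε
  have hceil := Nat.ceil_lt_add_one (zero_le_one.trans hx)
  have hle := Nat.le_ceil (n ^ ε)
  have hmul : n * n ^ ε ≤ n ^ (2 - ε) := by
    rw [← Real.rpow_one_add' hn0.le (by linarith)]
    exact Real.rpow_le_rpow_of_exponent_le hn (by linarith)
  have hdiv : n * (n / (⌈n ^ ε⌉₊ + 1)) ≤ n ^ (2 - ε) := by
    rw [Real.rpow_sub hn0, Real.rpow_two, ← mul_div_assoc, ← sq]
    gcongr
    linarith
  nlinarith

theorem mainTheorem3 :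
    ∃ (A : Symbolic.Prog) (C : ℝ) (k : ℕ),
      ∀ (V : Type*) [Fintype V] [Nonempty V] [MeasurableSpace V] [DiscreteMeasurableSpace V]
        (P : MDP V) (T : Set V) (ρ : Symbolic.Picker V),
        (∀ p : ℕ, ∃ s, Symbolic.Computes ρ A P T p (P.ASW (P.Reach T)) s) ∧
        ∀ ε : ℝ, 0 < ε → ε ≤ 1 / 2 →
          ∃ s, Symbolic.Computes ρ A P T ⌈(Fintype.card V : ℝ) ^ ε⌉₊ (P.ASW (P.Reach T)) s ∧
            (s.ops : ℝ) ≤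
              C * (Fintype.card V : ℝ) ^ (2 - ε) * Real.log (Fintype.card V) ^ k ∧
            s.peak ≤
              (⌊C * (Fintype.card V : ℝ) ^ ε * Real.log (Fintype.card V) ^ k⌋₊ : ℕ∞) := by
  refine ⟨Symbolic.aswProg, 552, 1, fun V _ _ _ _ P T ρ => ⟨fun p => ?_, fun ε hε hε' => ?_⟩⟩
  · exact (Symbolic.exists_computes_asw P T ρ p).imp fun _ hs => hs.1
  obtain ⟨s, hs, hpeak, hops⟩ := Symbolic.exists_computes_asw P T ρ ⌈(Fintype.card V : ℝ) ^ ε⌉₊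
  have hL := Symbolic.labelSize_le_log P.two_le_card
  rw [Nat.card_eq_fintype_card] at hops hL
  have hn : (1 : ℝ) ≤ Fintype.card V := mod_cast Fintype.card_pos
  refine ⟨s, hs, ?_, hpeak.trans (Nat.cast_le.2 (Nat.le_floor ?_))⟩
  · set n := Fintype.card V
    set p := ⌈(n : ℝ) ^ ε⌉₊
    calc (s.ops : ℝ)
        ≤ 46 * Symbolic.labelSize V * (n * (p + 1 + (n / (p + 1) : ℕ))) := mod_cast hops
      _ ≤ 46 * (3 * Real.log n) * (n * (p + 1 + n / (p + 1))) := by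
        gcongr
        exact Nat.cast_div_le.trans_eq (by push_cast; rfl)
      _ ≤ 46 * (3 * Real.log n) * (4 * n ^ (2 - ε)) :=
        mul_le_mul_of_nonneg_left (mul_ceil_rpow_add_div_le hn hε.le hε') (by positivity)
      _ = 552 * n ^ (2 - ε) * Real.log n ^ 1 := by ring
  · have hL1 : (1 : ℝ) ≤ Symbolic.labelSize V := mod_cast Nat.le_add_left ..
    calc ((Symbolic.labelSize V + 10 : ℕ) : ℝ) ≤ 33 * Real.log (Fintype.card V) := by
          push_cast; linarith
      _ ≤ 552 * Fintype.card V ^ ε * Real.log (Fintype.card V) ^ 1 := by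
          rw [pow_one]
          gcongr
          linarith [Real.one_le_rpow hn hε.le]
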